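/- Fix an integer $m\ge 0$. By a (possibly disconnected) toric surface $S$ we mean a nonempty finite disjoint union of nonsingular projective toric surfaces over $\mathbb{C}$; write $c_1, c_2$ for the Chern classes of its tangent bundle. To such an $S$ and classes $\gamma_1,\dots,\gamma_m\in H^2(S;\mathbb{Q})$ associate the $\left(\binom{m+1}{2}+m+2\right)$-tuple of rational numbers $$\left\{\int_S \gamma_i\gamma_j\right\}_{1\le i\le j\le m}\cup\left\{\int_S \gamma_i c_1\right\}_{1\le i\le m}\cup\left\{\int_S c_1^2,\ \int_S c_2\right\}.$$ Then the set of all tuples obtained in this way, as $S$ varies over all possibly disconnected toric surfaces and $\gamma_1,\dots,\gamma_m$ vary over all classes in $H^2(S;\mathbb{Q})$, is Zariski dense in $\mathbb{Q}^{\binom{m+1}{2}+m+2}$. -/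

import Mathlib

open scoped Manifold ContDiff

noncomputable section

namespace ToricSurf

/-- The model space `ℂ²` of complex surfaces. -/
abbrev C2 : Type := Fin 2 → ℂ

/-! ### Smooth differential forms on a complex surface, in charts -/

section Forms

variable (S : Type) [TopologicalSpace S] [ChartedSpace C2 S]

/-- A smooth complex-valued differential `k`-form on the open subset `W` of `S`: a `k`-form on
`e.target ∩ e.symm ⁻¹' W ⊆ ℂ² = ℝ⁴` for every chart `e` of the atlas, smooth in the real sense, such
that these forms are exchanged by pull-back along the changes of charts. Values at charts outside
the atlas and at points outside `e.target ∩ e.symm ⁻¹' W` carry no meaning and are never used. -/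
structure DForm (k : ℕ) (W : Set S) where
  /-- the expression of the form in a chart -/
  toFun : OpenPartialHomeomorph S C2 → C2 → C2 [⋀^Fin k]→L[ℝ] ℂ
  smooth : ∀ e ∈ atlas C2 S, ContDiffOn ℝ ∞ (toFun e) (e.target ∩ e.symm ⁻¹' W)
  compat : ∀ e ∈ atlas C2 S, ∀ e' ∈ atlas C2 S, ∀ z ∈ e.target,
    e.symm z ∈ e'.source → e.symm z ∈ W →
      toFun e z = (toFun e' (e' (e.symm z))).compContinuousLinearMap
        (fderiv ℝ (fun w => e' (e.symm w)) z)

/-- A closed form: `dα = 0` in every chart. -/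
def DForm.IsClosed {S : Type} [TopologicalSpace S] [ChartedSpace C2 S] {k : ℕ}
    (α : DForm S k Set.univ) : Prop :=
  ∀ e ∈ atlas C2 S, ∀ z ∈ e.target, extDeriv (α.toFun e) z = 0

/-- The de Rham class of the closed `2`-form `α` lies in the image of
`H²(S; ℚ) → H²(S; ℂ)`, where `H²(S; ℚ)` is Čech cohomology and the comparison with de Rham cohomology
is the Čech-de Rham zigzag: for some open cover `W`, there are `1`-forms `A a` on `W a` with
`d (A a) = α`, smooth functions `f a b` on `W a ∩ W b` with `d (f a b) = A b - A a`, and the Čech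
`2`-cocycle `f a b + f b c - f a c` on the triple intersections has rational values (it is locally
constant because its differential vanishes). -/
def DForm.IsRational {S : Type} [TopologicalSpace S] [ChartedSpace C2 S]
    (α : DForm S 2 Set.univ) : Prop :=
  ∃ (ι : Type) (W : ι → Set S) (A : ∀ a, DForm S 1 (W a)) (f : ι → ι → S → ℂ),
    (∀ a, IsOpen (W a)) ∧ (⋃ a, W a) = Set.univ ∧
    (∀ a, ∀ e ∈ atlas C2 S, ∀ z ∈ e.target, e.symm z ∈ W a →
      extDeriv ((A a).toFun e) z = α.toFun e z) ∧
    (∀ a b, ∀ e ∈ atlas C2 S,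
      ContDiffOn ℝ ∞ (fun z => f a b (e.symm z)) (e.target ∩ e.symm ⁻¹' (W a ∩ W b))) ∧
    (∀ a b, ∀ e ∈ atlas C2 S, ∀ z ∈ e.target, e.symm z ∈ W a ∩ W b → ∀ v : C2,
      fderiv ℝ (fun w => f a b (e.symm w)) z v
        = (A b).toFun e z ![v] - (A a).toFun e z ![v]) ∧
    (∀ a b c, ∀ x ∈ W a ∩ W b ∩ W c, ∃ r : ℚ, f a b x + f b c x - f a c x = (r : ℂ))

/-- Classes in `H²(S; ℚ)`, given by closed `2`-forms that represent them. By Stokes' theorem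
integrals over a compact `S` of products with closed forms depend only on the classes. -/
structure RationalClass where
  form : DForm S 2 Set.univ
  closed : form.IsClosed
  rational : form.IsRational

end Forms

/-! ### Wedge products in top degree and integration -/

/-- The oriented real basis `∂/∂x₁, ∂/∂y₁, ∂/∂x₂, ∂/∂y₂` of `ℂ²`, with `z_k = x_k + i y_k`. -/
def realBasis : Fin 4 → C2 :=
  ![![1, 0], ![Complex.I, 0], ![0, 1], ![0, Complex.I]]

/-- The coefficient of `dx₁ ∧ dy₁ ∧ dx₂ ∧ dy₂` in `a ∧ b`, for two alternating bilinear forms `a, b`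
on `ℂ²`: the sum over the six `(2,2)`-shuffles. -/
def wedgeCoeff (a b : C2 → C2 → ℂ) : ℂ :=
  let A := fun i j => a (realBasis i) (realBasis j)
  let B := fun i j => b (realBasis i) (realBasis j)
  A 0 1 * B 2 3 - A 0 2 * B 1 3 + A 0 3 * B 1 2
    + A 1 2 * B 0 3 - A 1 3 * B 0 2 + A 2 3 * B 0 1

/-- `HasIntegral S ρ r` says that the top-degree form which in each chart `e` of the atlas equals
`ρ e · dx₁ ∧ dy₁ ∧ dx₂ ∧ dy₂` has integral `r` over `S`, for the complex orientation: `S` is cut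
into finitely many Borel pieces `B n`, each contained in the domain of a chart `e n`, and `r` is the
sum of the integrals of the pieces with respect to Lebesgue measure. By the change of variables
formula `r` does not depend on the choice of the pieces and charts. -/
def HasIntegral (S : Type) [TopologicalSpace S] [ChartedSpace C2 S]
    (ρ : OpenPartialHomeomorph S C2 → C2 → ℂ) (r : ℂ) : Prop :=
  ∃ (N : ℕ) (e : Fin N → OpenPartialHomeomorph S C2) (B : Fin N → Set S),
    (∀ n, e n ∈ atlas C2 S) ∧ (∀ n, B n ⊆ (e n).source) ∧
    (∀ n, MeasurableSet (e n '' B n)) ∧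
    (∀ n n', n ≠ n' → Disjoint (B n) (B n')) ∧ (⋃ n, B n) = Set.univ ∧
    (∀ n, MeasureTheory.IntegrableOn (ρ (e n)) (e n '' B n)) ∧
    r = ∑ n, ∫ z in e n '' B n, ρ (e n) z

/-! ### Chern forms of the tangent bundle -/

/-- The complex Jacobian matrix `∂w_i/∂z_j` at `z` of the change of charts `w = e' (e.symm z)`. -/
def jacobian {S : Type} [TopologicalSpace S] (e e' : OpenPartialHomeomorph S C2) (z : C2) :
    Matrix (Fin 2) (Fin 2) ℂ :=
  fun i j => fderiv ℂ (fun w => e' (e.symm w)) z (Pi.single j 1) i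

/-- A smooth connection on the (complex, rank two) tangent bundle of a complex surface, given by its
matrix `θ` of `1`-forms with respect to the frame `∂/∂z₁, ∂/∂z₂` of each chart, that is
`∇ (∂/∂z_j) = ∑ i, θ i j ⊗ ∂/∂z_i`; the change of frame formula is `J θ = dJ + θ' J`. -/
structure TangentConnection (S : Type) [TopologicalSpace S] [ChartedSpace C2 S] where
  θ : OpenPartialHomeomorph S C2 → Fin 2 → Fin 2 → C2 → C2 [⋀^Fin 1]→L[ℝ] ℂ
  smooth : ∀ e ∈ atlas C2 S, ∀ i j, ContDiffOn ℝ ∞ (θ e i j) e.target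
  transform : ∀ e ∈ atlas C2 S, ∀ e' ∈ atlas C2 S, ∀ z ∈ e.target, e.symm z ∈ e'.source →
    ∀ (i j : Fin 2) (v : C2),
      ∑ k, jacobian e e' z i k * θ e k j z ![v]
        = fderiv ℝ (fun w => jacobian e e' w i j) z v
          + ∑ k, θ e' i k (e' (e.symm z)) ![fderiv ℝ (fun w => e' (e.symm w)) z v]
              * jacobian e e' z k j

namespace TangentConnection

variable {S : Type} [TopologicalSpace S] [ChartedSpace C2 S] (D : TangentConnection S)

/-- The curvature matrix `Θ = dθ + θ ∧ θ` in the chart `e`, at the point `z`. -/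
def curvature (e : OpenPartialHomeomorph S C2) (z : C2) (i j : Fin 2) (u v : C2) : ℂ :=
  extDeriv (D.θ e i j) z ![u, v]
    + ∑ k, (D.θ e i k z ![u] * D.θ e k j z ![v] - D.θ e i k z ![v] * D.θ e k j z ![u])

/-- The first Chern form `(i / 2π) tr Θ`; it represents `c₁(TS)`. -/
def chernForm₁ (e : OpenPartialHomeomorph S C2) (z : C2) (u v : C2) : ℂ :=
  Complex.I / (2 * Real.pi) * (D.curvature e z 0 0 u v + D.curvature e z 1 1 u v)

/-- The coefficient of `dx₁ ∧ dy₁ ∧ dx₂ ∧ dy₂` in the second Chern form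
`det ((i / 2π) Θ) = (i / 2π)² (Θ₀₀ ∧ Θ₁₁ - Θ₀₁ ∧ Θ₁₀)`; this form represents `c₂(TS)`. -/
def chernForm₂Coeff (e : OpenPartialHomeomorph S C2) (z : C2) : ℂ :=
  (Complex.I / (2 * Real.pi)) ^ 2 *
    (wedgeCoeff (D.curvature e z 0 0) (D.curvature e z 1 1)
      - wedgeCoeff (D.curvature e z 0 1) (D.curvature e z 1 0))

end TangentConnection

/-! ### Toric surfaces -/

/-- The open subset `C` of the complex surface `S` is a (smooth) toric surface: it contains an
embedded torus `j : (ℂˣ)² → C` and is covered by holomorphic charts onto all of `ℂ²`, each containing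
this torus, in which the torus is included by an invertible Laurent monomial map. These charts are
the torus-invariant affine open sets `Spec ℂ[σ^∨ ∩ ℤ²] ≅ ℂ²` of the maximal cones `σ` of the fan, which
are glued along the torus by Laurent monomials. When `C` is compact and Hausdorff these are precisely
the smooth complete (equivalently, smooth projective) toric surfaces. -/
def IsToricOn {S : Type} [TopologicalSpace S] [ChartedSpace C2 S] (C : Set S) : Prop :=
  ∃ j : (Fin 2 → ℂˣ) → S, ∀ p ∈ C,
    ∃ φ ∈ IsManifold.maximalAtlas 𝓘(ℂ, C2) ω S, ∃ A : Matrix (Fin 2) (Fin 2) ℤ,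
      p ∈ φ.source ∧ φ.source ⊆ C ∧ φ.target = Set.univ ∧ IsUnit A.det ∧
      ∀ t : Fin 2 → ℂˣ, j t ∈ φ.source ∧
        ∀ k, φ (j t) k = ((∏ l, t l ^ A k l : ℂˣ) : ℂ)

/-- A possibly disconnected nonsingular projective toric surface over `ℂ`: a nonempty compact
complex surface each of whose (necessarily finitely many) connected components is toric. -/
structure ToricSurface where
  carrier : Type
  [top : TopologicalSpace carrier]
  [charted : ChartedSpace C2 carrier]
  [manifold : IsManifold 𝓘(ℂ, C2) ω carrier]
  [t2 : T2Space carrier]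
  [compact : CompactSpace carrier]
  [nonempty : Nonempty carrier]
  toric : ∀ p : carrier, IsToricOn (connectedComponent p)

attribute [instance] ToricSurface.top ToricSurface.charted ToricSurface.manifold
  ToricSurface.t2 ToricSurface.compact ToricSurface.nonempty

/-! ### The tuples of integrals -/

/-- The index set of the tuples: pairs `i ≤ j`, indices `i`, and two more entries; it has
`(m + 1).choose 2 + m + 2` elements. -/
abbrev TupleIndex (m : ℕ) : Type :=
  {p : Fin m × Fin m // p.1 ≤ p.2} ⊕ Fin m ⊕ Fin 2

/-- `q` is the tuple of the integrals `∫ γ_i γ_j` (`i ≤ j`), `∫ γ_i c₁`, `∫ c₁²`, `∫ c₂` over `S`. The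
Chern classes are represented by the Chern forms of some connection on the tangent bundle; the
integrals do not depend on it. -/
def IsTupleOf {m : ℕ} (S : ToricSurface) (γ : Fin m → RationalClass S.carrier)
    (q : TupleIndex m → ℚ) : Prop :=
  ∃ D : TangentConnection S.carrier,
    (∀ p : {p : Fin m × Fin m // p.1 ≤ p.2},
      HasIntegral S.carrier
        (fun e z => wedgeCoeff (fun u v => (γ p.1.1).form.toFun e z ![u, v])
          (fun u v => (γ p.1.2).form.toFun e z ![u, v]))
        (q (Sum.inl p))) ∧
    (∀ i : Fin m,
      HasIntegral S.carrier
        (fun e z => wedgeCoeff (fun u v => (γ i).form.toFun e z ![u, v]) (D.chernForm₁ e z))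
        (q (Sum.inr (Sum.inl i)))) ∧
    HasIntegral S.carrier (fun e z => wedgeCoeff (D.chernForm₁ e z) (D.chernForm₁ e z))
      (q (Sum.inr (Sum.inr 0))) ∧
    HasIntegral S.carrier (fun e z => D.chernForm₂Coeff e z)
      (q (Sum.inr (Sum.inr 1)))

/-- A subset of affine space `k^σ` is Zariski dense if the only Zariski closed set (the zero locus
of an ideal of polynomials) that contains it is the whole space. -/
def IsZariskiDense {k σ : Type*} [Field k] (T : Set (σ → k)) : Prop :=
  ∀ I : Ideal (MvPolynomial σ k), T ⊆ MvPolynomial.zeroLocus k I →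
    MvPolynomial.zeroLocus k I = Set.univ

end ToricSurf

end

/-! The integrals add up over disjoint unions, so finite nonempty sums of tuples are again tuples. A
polynomial that vanishes at all combinations of some vectors with positive integer coefficients
vanishes on their linear span. Hence it suffices to find tuples that span the whole space
(`isZariskiDense_of_span_eq_top`).

Two connected surfaces are enough: the projective plane, with `(c₁², c₂) = (9, 3)`, and the product
of two projective lines, with `(8, 4)`. So are classes of the form `γ_i = a_i c₁`, with a rational
number `a_i` on each component. One component then contributes `(a_i a_j c₁², a_i c₁², c₁², c₂)`.
The even part in `a`, polarised, yields the entries `γ_i γ_j`; the odd part yields the entries `γ_i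
c₁`; and `9 * 4 - 8 * 3 ≠ 0` separates the last two entries (`span_chernTuple`).

The remaining work is to realise these tuples by actual surfaces, forms and integrals. The surfaces
are built from exponents of monomials, as sets of rank one projections, that is, inside a projective
space. In a chart the first Chern form is `d` of `(i / 2π) tr θ`, and two such primitives differ by
`(i / 2π) d log det J`, with `J` the Jacobian of the change of charts. This shows both that the form
is globally defined and that its Čech cocycle is integral
(`TangentConnection.isRational_chernDForm`). The Levi-Civita connections of the Fubini-Study metrics
have the same Christoffel symbols in all affine charts, and the top degree Chern forms are constant
multiples of one density of mass one. As one chart misses only a null set, the Chern numbers are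
integrals over `ℂ²` (`Union.hasIntegral`, `Union.isTupleOf`). -/

noncomputable section

namespace ToricSurf

open ComplexConjugate

/-! ### Toric surfaces covered by affine planes glued along Laurent monomials -/

/-- Combinatorial data of a smooth complete fan in `ℤ²` together with an embedding of its toric
surface in a projective space with homogeneous coordinates indexed by the maximal cones. In the
chart of the cone `i` the coordinate of index `k` is the monomial with exponents `exponent i k`, and
the two affine coordinates of this chart are the ones of index `neighbour i 0`, `neighbour i 1`. -/
structure MonomialAtlas where
  ι : Type
  [fintype : Fintype ι]
  [nonempty : Nonempty ι]
  exponent : ι → ι → Fin 2 → ℕ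
  neighbour : ι → Fin 2 → ι
  exponent_self : ∀ i l, exponent i i l = 0
  exponent_ne_zero : ∀ i j, i ≠ j → exponent i j ≠ 0
  exponent_neighbour : ∀ i a l, exponent i (neighbour i a) l = if l = a then 1 else 0
  -- With homogeneous coordinates `X`, this compares exponents in `X k / X j = ∏ a, (X (neighbour j
  -- a) / X j) ^ exponent j k a` on the chart `i`; denominators are cleared to stay in `ℕ`.
  exponent_glue : ∀ i j k l,
    exponent i k l + (∑ a, exponent j k a) * exponent i j l =
      exponent i j l + ∑ a, exponent j k a * exponent i (neighbour j a) l

namespace MonomialAtlas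

attribute [instance] fintype nonempty

variable (M : MonomialAtlas)

/-- The homogeneous coordinates of the point of the chart `i` with affine coordinates `z`. -/
def hom (i : M.ι) (z : C2) (k : M.ι) : ℂ := ∏ l, z l ^ M.exponent i k l

/-- The change of coordinates from the chart `i` to the chart `j`. -/
def trans (i j : M.ι) (z : C2) : C2 := fun a => M.hom i z (M.neighbour j a) / M.hom i z j

@[simp] lemma hom_self (i : M.ι) (z : C2) : M.hom i z i = 1 := by
  simp [hom, M.exponent_self]

@[simp] lemma hom_neighbour (i : M.ι) (z : C2) (a : Fin 2) :
    M.hom i z (M.neighbour i a) = z a := by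
  simp only [hom, M.exponent_neighbour]
  rw [Finset.prod_eq_single a] <;> simp +contextual

lemma hom_glue (i j k : M.ι) (z : C2) :
    M.hom i z k * M.hom i z j ^ (∑ a, M.exponent j k a) =
      M.hom i z j * ∏ a, M.hom i z (M.neighbour j a) ^ M.exponent j k a := by
  have h : ∀ l, z l ^ M.exponent i k l * (z l ^ M.exponent i j l) ^ (∑ a, M.exponent j k a) =
      z l ^ M.exponent i j l *
        ∏ a, (z l ^ M.exponent i (M.neighbour j a) l) ^ M.exponent j k a := by
    intro l
    simp only [← pow_mul]
    rw [Finset.prod_pow_eq_pow_sum, ← pow_add, ← pow_add]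
    congr 1
    have := M.exponent_glue i j k l
    simp only [mul_comm] at this ⊢
    exact this
  simp only [hom, ← Finset.prod_pow]
  rw [Finset.prod_comm (s := Finset.univ (α := Fin 2)), ← Finset.prod_mul_distrib,
    ← Finset.prod_mul_distrib]
  exact Finset.prod_congr rfl fun l _ => h l

/-- By `hom_glue`, the coordinate vectors of a point in two charts are proportional, so both charts
describe the same point of projective space. -/
lemma hom_trans (i j k : M.ι) {z : C2} (hz : M.hom i z j ≠ 0) :
    M.hom j (M.trans i j z) k = M.hom i z k / M.hom i z j := by
  have h := M.hom_glue i j k z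
  have h1 : M.hom j (M.trans i j z) k =
      (∏ a, M.hom i z (M.neighbour j a) ^ M.exponent j k a) /
        M.hom i z j ^ (∑ a, M.exponent j k a) := by
    rw [hom]
    simp only [trans, div_pow, Finset.prod_div_distrib, Finset.prod_pow_eq_pow_sum]
  rw [h1, div_eq_div_iff (pow_ne_zero _ hz) hz, h, mul_comm]

lemma hom_ne_zero_of_torus (i k : M.ι) {z : C2} (hz : ∀ l, z l ≠ 0) : M.hom i z k ≠ 0 :=
  Finset.prod_ne_zero_iff.2 fun l _ => pow_ne_zero _ (hz l)

/-- The origin of a chart is the fixed point of its cone and lies in no other chart;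
`Union.chart_injective` rests on this. -/
lemma hom_zero (i : M.ι) {k : M.ι} (h : i ≠ k) : M.hom i 0 k = 0 := by
  obtain ⟨l, hl⟩ := Function.ne_iff.1 (M.exponent_ne_zero i k h)
  exact Finset.prod_eq_zero (Finset.mem_univ l) (by simpa using hl)

lemma contDiff_hom (i k : M.ι) {n : ℕ∞ω} : ContDiff ℂ n fun z => M.hom i z k := by
  unfold hom
  fun_prop

lemma continuous_hom (i k : M.ι) : Continuous fun z => M.hom i z k :=
  (M.contDiff_hom i k (n := 0)).continuous

lemma contDiffOn_trans (i j : M.ι) {n : ℕ∞ω} :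
    ContDiffOn ℂ n (M.trans i j) {z | M.hom i z j ≠ 0} := by
  refine contDiffOn_pi.2 fun a => ?_
  exact (M.contDiff_hom i _).contDiffOn.div (M.contDiff_hom i j).contDiffOn fun z hz => hz

/-- The squared norm of a vector of homogeneous coordinates. -/
def normSq {ι : Type} [Fintype ι] (v : ι → ℂ) : ℂ := ∑ c, v c * conj (v c)

lemma normSq_eq {ι : Type} [Fintype ι] (v : ι → ℂ) :
    normSq v = ((∑ c, Complex.normSq (v c) : ℝ) : ℂ) := by
  simp [normSq, Complex.mul_conj]

lemma normSq_ne_zero {ι : Type} [Fintype ι] {v : ι → ℂ} {c : ι} (h : v c ≠ 0) :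
    normSq v ≠ 0 := by
  rw [normSq_eq, Complex.ofReal_ne_zero]
  exact (Finset.sum_pos' (fun _ _ => Complex.normSq_nonneg _)
    ⟨c, Finset.mem_univ _, Complex.normSq_pos.2 h⟩).ne'

/-- The matrix of the orthogonal projection to the line spanned by `v`. -/
def lineProj {ι : Type} [Fintype ι] (v : ι → ℂ) : ι → ι → ℂ :=
  fun a b => v a * conj (v b) / normSq v

/-- Numerator and denominator both scale by `|c|⁻²`. The projection thus depends only on the line,
and projective space becomes a set of matrices, Hausdorff without any quotient. -/
lemma lineProj_div {ι : Type} [Fintype ι] (v : ι → ℂ) {c : ℂ} (hc : c ≠ 0) :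
    lineProj (fun a => v a / c) = lineProj v := by
  have hc' : conj c ≠ 0 := by simpa using hc
  have h : normSq (fun a => v a / c) = normSq v / (c * conj c) := by
    simp only [normSq, Finset.sum_div, map_div₀]
    refine Finset.sum_congr rfl fun a _ => ?_
    field_simp
  ext a b
  simp only [lineProj, h, map_div₀]
  by_cases hv : normSq v = 0
  · simp [hv]
  · field_simp

/-- The toric surface of a monomial atlas, as a space of projections to lines. -/
def Space : Type := {P : M.ι → M.ι → ℂ // ∃ i z, lineProj (M.hom i z) = P}

instance : TopologicalSpace M.Space := inferInstanceAs (TopologicalSpace (Subtype _))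
instance : T2Space M.Space := inferInstanceAs (T2Space (Subtype _))

/-- The point of the chart `i` with affine coordinates `z`. -/
def pt (i : M.ι) (z : C2) : M.Space := ⟨lineProj (M.hom i z), i, z, rfl⟩

lemma exists_pt (x : M.Space) : ∃ i z, M.pt i z = x := by
  obtain ⟨P, i, z, h⟩ := x
  exact ⟨i, z, Subtype.ext h⟩

lemma normSq_hom_ne_zero (i : M.ι) (z : C2) : normSq (M.hom i z) ≠ 0 :=
  normSq_ne_zero (c := i) (by simp)

lemma continuous_pt (i : M.ι) : Continuous (M.pt i) := by
  refine Continuous.subtype_mk (continuous_pi fun a => continuous_pi fun b => ?_) _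
  have h : Continuous fun z => normSq (M.hom i z) := by
    unfold normSq
    exact continuous_finsetSum _ fun c _ => (M.continuous_hom i c).mul
      (Complex.continuous_conj.comp (M.continuous_hom i c))
  exact ((M.continuous_hom i a).mul (Complex.continuous_conj.comp (M.continuous_hom i b))).div h
    (M.normSq_hom_ne_zero i)

lemma pt_trans (i j : M.ι) {z : C2} (hz : M.hom i z j ≠ 0) :
    M.pt j (M.trans i j z) = M.pt i z := by
  apply Subtype.ext
  have h : M.hom j (M.trans i j z) = fun k => M.hom i z k / M.hom i z j :=
    funext fun k => M.hom_trans i j k hz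
  change lineProj _ = lineProj _
  rw [h, lineProj_div _ hz]

lemma pt_diag_ne_zero_iff (i j : M.ι) (z : C2) : (M.pt i z).1 j j ≠ 0 ↔ M.hom i z j ≠ 0 := by
  simp [pt, lineProj, M.normSq_hom_ne_zero i z]

/-- The factors `conj (X j)` and the norm cancel, so column `j` of the projection recovers the
affine coordinates of the chart `j`. -/
lemma pt_div_diag (i j k : M.ι) {z : C2} (hz : M.hom i z j ≠ 0) :
    (M.pt i z).1 k j / (M.pt i z).1 j j = M.hom i z k / M.hom i z j := by
  have h1 := M.normSq_hom_ne_zero i z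
  have h2 : conj (M.hom i z j) ≠ 0 := by simpa using hz
  simp only [pt, lineProj]
  field_simp

lemma continuous_coord (j k : M.ι) : Continuous fun x : M.Space => x.1 j k :=
  (continuous_apply_apply j k).comp continuous_subtype_val

/-- The affine chart of index `j`. -/
def chart (j : M.ι) : OpenPartialHomeomorph M.Space C2 where
  toFun x a := x.1 (M.neighbour j a) j / x.1 j j
  invFun := M.pt j
  source := {x | x.1 j j ≠ 0}
  target := Set.univ
  map_source' _ _ := Set.mem_univ _
  map_target' z _ := by simp [pt_diag_ne_zero_iff]
  left_inv' x hx := by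
    obtain ⟨i, z, rfl⟩ := M.exists_pt x
    have hz := (M.pt_diag_ne_zero_iff i j z).1 hx
    exact (congrArg (M.pt j) (funext fun a => M.pt_div_diag i j _ hz)).trans (M.pt_trans i j hz)
  right_inv' z _ := by
    funext a
    rw [M.pt_div_diag j j _ (by simp)]
    simp
  open_source := by
    exact isOpen_ne.preimage (M.continuous_coord j j)
  open_target := isOpen_univ
  continuousOn_toFun := by
    exact continuousOn_pi.2 fun a => (M.continuous_coord _ j).continuousOn.div
      (M.continuous_coord j j).continuousOn fun x hx => hx
  continuousOn_invFun := (M.continuous_pt j).continuousOn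

@[simp] lemma chart_target (j : M.ι) : (M.chart j).target = Set.univ := rfl

@[simp] lemma pt_mem_chart_source (i j : M.ι) (z : C2) :
    M.pt i z ∈ (M.chart j).source ↔ M.hom i z j ≠ 0 := M.pt_diag_ne_zero_iff i j z

lemma chart_pt (i j : M.ι) {z : C2} (hz : M.hom i z j ≠ 0) :
    M.chart j (M.pt i z) = M.trans i j z :=
  funext fun _ => M.pt_div_diag i j _ hz

/-- Dividing by the homogeneous coordinate of largest modulus bounds all the others by one.
Compactness follows, since finitely many closed polydiscs cover the space. -/
lemma exists_pt_norm_le_one (x : M.Space) : ∃ i z, ‖z‖ ≤ 1 ∧ M.pt i z = x := by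
  obtain ⟨i, z, rfl⟩ := M.exists_pt x
  obtain ⟨j, hj⟩ := Finite.exists_max fun k => ‖M.hom i z k‖
  have hj0 : M.hom i z j ≠ 0 := by
    have := hj i
    rw [hom_self, norm_one] at this
    exact norm_pos_iff.1 (by linarith)
  refine ⟨j, M.trans i j z, ?_, M.pt_trans i j hj0⟩
  refine (pi_norm_le_iff_of_nonneg zero_le_one).2 fun a => ?_
  rw [trans, norm_div]
  exact div_le_one_of_le₀ (hj _) (norm_nonneg _)

instance : CompactSpace M.Space := by
  have h : (Set.univ : Set M.Space) = ⋃ i, M.pt i '' Metric.closedBall 0 1 := by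
    refine (Set.eq_univ_of_forall fun x => ?_).symm
    obtain ⟨i, z, hz, rfl⟩ := M.exists_pt_norm_le_one x
    exact Set.mem_iUnion.2 ⟨i, z, by simpa using hz, rfl⟩
  exact ⟨h ▸ isCompact_iUnion fun i =>
    (isCompact_closedBall 0 1).image (M.continuous_pt i)⟩

/-- The inclusion of the torus. -/
def torusPt (t : Fin 2 → ℂˣ) : M.Space := M.pt (Classical.arbitrary _) fun l => t l

lemma torusPt_mem_chart_source (j : M.ι) (t : Fin 2 → ℂˣ) :
    M.torusPt t ∈ (M.chart j).source :=
  (M.pt_mem_chart_source _ _ _).2 (M.hom_ne_zero_of_torus _ _ fun l => (t l).ne_zero)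

instance : ConnectedSpace M.Space := by
  have h : (Set.univ : Set M.Space) = ⋃ i, (M.chart i).source := by
    refine (Set.eq_univ_of_forall fun x => ?_).symm
    obtain ⟨i, z, rfl⟩ := M.exists_pt x
    exact Set.mem_iUnion.2 ⟨i, by simp⟩
  have hc : ∀ i, IsPreconnected (M.chart i).source := fun i => by
    rw [← (M.chart i).symm_image_target_eq_source, chart_target]
    exact isPreconnected_univ.image _ (M.continuous_pt i).continuousOn
  have : PreconnectedSpace M.Space :=
    ⟨h ▸ isPreconnected_iUnion ⟨_, Set.mem_iInter.2 fun i => M.torusPt_mem_chart_source i 1⟩ hc⟩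
  exact ⟨⟨M.torusPt 1⟩⟩

/-- The exponents of the Laurent monomials that express the coordinates of the chart `j` on the
torus. -/
def torusMatrix (i j : M.ι) : Matrix (Fin 2) (Fin 2) ℤ :=
  fun a l => (M.exponent i (M.neighbour j a) l : ℤ) - M.exponent i j l

lemma torusMatrix_self (i : M.ι) : M.torusMatrix i i = 1 := by
  ext a l
  simp [torusMatrix, M.exponent_self, M.exponent_neighbour, Matrix.one_apply, eq_comm]

/-- Exponent matrices compose like the changes of charts; this is a linear form of `exponent_glue`.
Taking `k = i` shows that they are unimodular. -/
lemma torusMatrix_mul (i j k : M.ι) :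
    M.torusMatrix j k * M.torusMatrix i j = M.torusMatrix i k := by
  have h : ∀ c l, (M.exponent i c l : ℤ) - M.exponent i j l =
      ∑ a, (M.exponent j c a : ℤ) * M.torusMatrix i j a l := by
    intro c l
    have := M.exponent_glue i j c l
    zify at this
    simp only [torusMatrix, mul_sub, Finset.sum_sub_distrib, ← Finset.sum_mul]
    linarith
  ext a l
  rw [Matrix.mul_apply]
  have h1 := h (M.neighbour k a) l
  have h2 := h k l
  simp only [torusMatrix] at h1 h2 ⊢
  rw [← sub_sub_sub_cancel_right _ _ (M.exponent i j l : ℤ), h1, h2, ← Finset.sum_sub_distrib]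
  exact Finset.sum_congr rfl fun b _ => by ring

lemma isUnit_det_torusMatrix (i j : M.ι) : IsUnit (M.torusMatrix i j).det := by
  have h := congrArg Matrix.det (M.torusMatrix_mul i j i)
  rw [Matrix.det_mul, torusMatrix_self, Matrix.det_one, mul_comm] at h
  exact IsUnit.of_mul_eq_one _ h

lemma chart_torusPt (j : M.ι) (t : Fin 2 → ℂˣ) (a : Fin 2) :
    M.chart j (M.torusPt t) a =
      ((∏ l, t l ^ M.torusMatrix (Classical.arbitrary _) j a l : ℂˣ) : ℂ) := by
  rw [torusPt, chart_pt _ _ _ (M.hom_ne_zero_of_torus _ _ fun l => (t l).ne_zero)]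
  simp only [trans, hom, torusMatrix, ← Finset.prod_div_distrib]
  push_cast
  refine Finset.prod_congr rfl fun l _ => ?_
  rw [zpow_sub₀ (t l).ne_zero, zpow_natCast, zpow_natCast]

end MonomialAtlas

end ToricSurf

namespace ToricSurf

/-! ### Disjoint unions of the toric surfaces of monomial atlases -/

section Union

variable {K : Type} (M : K → MonomialAtlas)

/-- The disjoint union of the toric surfaces of a family of monomial atlases. -/
def Union : Type := Σ k, (M k).Space

instance : TopologicalSpace (Union M) := inferInstanceAs (TopologicalSpace (Σ k, (M k).Space))
instance : T2Space (Union M) := inferInstanceAs (T2Space (Σ k, (M k).Space))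
instance [Finite K] : CompactSpace (Union M) := inferInstanceAs (CompactSpace (Σ k, (M k).Space))
instance [Nonempty K] : Nonempty (Union M) := 
  ⟨⟨Classical.arbitrary K, Classical.arbitrary _⟩⟩

namespace Union

/-- The indices of the affine charts. -/
abbrev Index : Type := Σ k, (M k).ι

variable {M}

/-- The point of a component. -/
def mk (k : K) (x : (M k).Space) : Union M := ⟨k, x⟩

lemma isOpenEmbedding_mk (k : K) : Topology.IsOpenEmbedding (mk (M := M) k) :=
  Topology.IsOpenEmbedding.sigmaMk (σ := fun k => (M k).Space)

/-- The affine charts. -/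
def chart (c : Index M) : OpenPartialHomeomorph (Union M) C2 :=
  ((M c.1).chart c.2).lift_openEmbedding (isOpenEmbedding_mk c.1)

@[simp] lemma chart_target (c : Index M) : (chart c).target = Set.univ := rfl

lemma chart_source (c : Index M) : (chart c).source = mk c.1 '' ((M c.1).chart c.2).source := rfl

lemma chart_mk (c : Index M) (x : (M c.1).Space) : chart c (mk c.1 x) = (M c.1).chart c.2 x :=
  OpenPartialHomeomorph.lift_openEmbedding_apply _ _

lemma mk_mem_chart_source (k : K) (i : (M k).ι) (x : (M k).Space) :
    mk k x ∈ (chart ⟨k, i⟩).source ↔ x ∈ ((M k).chart i).source :=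
  (isOpenEmbedding_mk k).injective.mem_set_image

lemma fst_eq_of_mem {c : Index M} {k : K} {x : (M k).Space}
    (h : mk k x ∈ (chart c).source) : k = c.1 := by
  obtain ⟨y, -, hy⟩ := h
  exact (congrArg Sigma.fst hy).symm

lemma symm_mem_source (k : K) (i j : (M k).ι) (z : C2) :
    (chart ⟨k, i⟩).symm z ∈ (chart ⟨k, j⟩).source ↔ (M k).hom i z j ≠ 0 :=
  (mk_mem_chart_source k j _).trans ((M k).pt_mem_chart_source i j z)

lemma chart_symm (k : K) (i j : (M k).ι) {z : C2} (hz : (M k).hom i z j ≠ 0) :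
    chart ⟨k, j⟩ ((chart (⟨k, i⟩ : Index M)).symm z) = (M k).trans i j z :=
  (chart_mk ⟨k, j⟩ _).trans ((M k).chart_pt i j hz)

/-- Two charts that meet are charts of the same component. -/
lemma exists_of_symm_mem_source {c c' : Index M} {z : C2}
    (h : (chart c).symm z ∈ (chart c').source) :
    ∃ k i j, c = ⟨k, i⟩ ∧ c' = ⟨k, j⟩ ∧ (M k).hom i z j ≠ 0 := by
  obtain ⟨k, i⟩ := c
  obtain ⟨k', j⟩ := c'
  obtain rfl : k = k' := fst_eq_of_mem h
  exact ⟨k, i, j, rfl, rfl, (symm_mem_source k i j z).1 h⟩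

lemma exists_mem_chart_source (x : Union M) : ∃ c : Index M, x ∈ (chart c).source := by
  obtain ⟨k, x⟩ := x
  obtain ⟨i, z, rfl⟩ := (M k).exists_pt x
  exact ⟨⟨k, i⟩, (mk_mem_chart_source k i _).2 (by simp)⟩

/-- Forms and connections are functions of the chart as a partial homeomorphism. Injectivity allows
data indexed by the cones to be transported to such functions. -/
lemma chart_injective : Function.Injective (chart (M := M)) := by
  rintro c c' h
  have h0 : (chart c).symm 0 ∈ (chart c).source := (chart c).map_target (Set.mem_univ _)
  rw [h] at h0
  nth_rw 1 [← h] at h0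
  obtain ⟨k, i, j, rfl, rfl, h1⟩ := exists_of_symm_mem_source h0
  by_cases hij : i = j
  · rw [hij]
  · exact absurd ((M k).hom_zero i hij) h1

instance : ChartedSpace C2 (Union M) where
  atlas := Set.range chart
  chartAt x := chart (exists_mem_chart_source x).choose
  mem_chart_source x := (exists_mem_chart_source x).choose_spec
  chart_mem_atlas _ := Set.mem_range_self _

lemma chart_mem_atlas (c : Index M) : chart c ∈ atlas C2 (Union M) := ⟨c, rfl⟩

instance : IsManifold 𝓘(ℂ, C2) ω (Union M) := by
  refine isManifold_of_contDiffOn _ _ _ ?_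
  rintro e e' ⟨c, rfl⟩ ⟨c', rfl⟩
  intro z hz
  have hz' : (chart c).symm z ∈ (chart c').source := by
    simpa using hz.1
  obtain ⟨k, i, j, rfl, rfl, h⟩ := exists_of_symm_mem_source hz'
  have ho : IsOpen {z | (M k).hom i z j ≠ 0} := isOpen_ne.preimage ((M k).continuous_hom i j)
  have h1 : ContDiffAt ℂ ω ((M k).trans i j) z :=
    ((M k).contDiffOn_trans i j).contDiffAt (ho.mem_nhds h)
  refine (h1.congr_of_eventuallyEq ?_).contDiffWithinAt
  filter_upwards [ho.mem_nhds h] with w hw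
  exact chart_symm k i j hw

lemma connectedComponent_mk (k : K) (x : (M k).Space) :
    connectedComponent (mk k x) = Set.range (mk (M := M) k) := by
  refine Set.Subset.antisymm ?_ ?_
  · exact isClopen_range_sigmaMk.connectedComponent_subset ⟨x, rfl⟩
  · exact (isPreconnected_range (isOpenEmbedding_mk k).continuous).subset_connectedComponent
      ⟨x, rfl⟩

lemma isToricOn_connectedComponent (p : Union M) : IsToricOn (connectedComponent p) := by
  obtain ⟨k, x⟩ := p
  change IsToricOn (connectedComponent (mk k x))
  rw [connectedComponent_mk]
  refine ⟨fun t => mk k ((M k).torusPt t), ?_⟩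
  rintro _ ⟨y, rfl⟩
  obtain ⟨i, z, rfl⟩ := (M k).exists_pt y
  refine ⟨chart ⟨k, i⟩, IsManifold.subset_maximalAtlas (chart_mem_atlas _),
    (M k).torusMatrix (Classical.arbitrary _) i, (mk_mem_chart_source k i _).2 (by simp), ?_, rfl,
    (M k).isUnit_det_torusMatrix _ _, fun t => ⟨?_, fun a => ?_⟩⟩
  · rw [chart_source]
    exact Set.image_subset_range _ _
  · exact (mk_mem_chart_source k i _).2 ((M k).torusPt_mem_chart_source i t)
  · rw [← (M k).chart_torusPt i t a]
    exact congrFun (chart_mk ⟨k, i⟩ _) a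

variable (M) in
/-- The disjoint union, as a possibly disconnected toric surface. -/
def toricSurface [Finite K] [Nonempty K] : ToricSurface where
  carrier := Union M
  toric := isToricOn_connectedComponent

end Union

end Union

end ToricSurf

namespace ToricSurf

open Topology

lemma minSmoothness_two_le : minSmoothness ℝ 2 ≤ (∞ : ℕ∞ω) := by
  rw [minSmoothness_of_isRCLikeNormedField]
  exact show ((2 : ℕ∞) : ℕ∞ω) ≤ ((⊤ : ℕ∞) : ℕ∞ω) from WithTop.coe_le_coe.2 le_top

/-! ### Changes of charts and their Jacobian matrices. -/

section Transition

variable {S : Type} [TopologicalSpace S] {e e' e'' : OpenPartialHomeomorph S C2} {z : C2}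

lemma eventually_mem_target (hz : z ∈ e.target) : ∀ᶠ w in 𝓝 z, w ∈ e.target :=
  e.open_target.mem_nhds hz

lemma eventually_symm_mem {U : Set S} (hU : IsOpen U) (hz : z ∈ e.target) (h : e.symm z ∈ U) :
    ∀ᶠ w in 𝓝 z, e.symm w ∈ U :=
  (e.continuousAt_symm hz).eventually (hU.mem_nhds h)

lemma transition_comp_eventuallyEq (hz : z ∈ e.target) (hz' : e.symm z ∈ e'.source) :
    (fun w => e'' (e.symm w)) =ᶠ[𝓝 z]
      (fun w => e'' (e'.symm w)) ∘ fun w => e' (e.symm w) := by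
  filter_upwards [eventually_symm_mem e'.open_source hz hz'] with w hw
  simp [e'.left_inv hw]

lemma jacobian_self (hz : z ∈ e.target) : jacobian e e z = 1 := by
  have h : (fun w => e (e.symm w)) =ᶠ[𝓝 z] fun w => w := by
    filter_upwards [eventually_mem_target hz] with w hw using e.right_inv hw
  ext i j
  rw [jacobian, h.fderiv_eq, fderiv_fun_id]
  simp [Matrix.one_apply, Pi.single_apply]

variable [ChartedSpace C2 S] [IsManifold 𝓘(ℂ, C2) ω S]

lemma contDiffAt_transition (he : e ∈ atlas C2 S) (he' : e' ∈ atlas C2 S) (hz : z ∈ e.target)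
    (hz' : e.symm z ∈ e'.source) : ContDiffAt ℂ ω (fun w => e' (e.symm w)) z := by
  have h := StructureGroupoid.compatible (contDiffGroupoid ω 𝓘(ℂ, C2)) he he'
  rw [contDiffGroupoid, mem_groupoid_of_pregroupoid] at h
  have h1 : ContDiffOn ℂ ω (fun w => e' (e.symm w)) (e.symm ≫ₕ e').source := by
    simpa [contDiffPregroupoid, Function.comp_def] using h.1
  refine h1.contDiffAt ((e.symm ≫ₕ e').open_source.mem_nhds ?_)
  simp [hz, hz']

lemma contDiffAt_transition_real (he : e ∈ atlas C2 S) (he' : e' ∈ atlas C2 S)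
    (hz : z ∈ e.target) (hz' : e.symm z ∈ e'.source) :
    ContDiffAt ℝ ω (fun w => e' (e.symm w)) z :=
  (contDiffAt_transition he he' hz hz').restrict_scalars ℝ

lemma differentiableAt_transition (he : e ∈ atlas C2 S) (he' : e' ∈ atlas C2 S)
    (hz : z ∈ e.target) (hz' : e.symm z ∈ e'.source) :
    DifferentiableAt ℝ (fun w => e' (e.symm w)) z :=
  (contDiffAt_transition_real he he' hz hz').differentiableAt (by simp)

lemma fderiv_transition_comp (he : e ∈ atlas C2 S) (he' : e' ∈ atlas C2 S)
    (he'' : e'' ∈ atlas C2 S) (hz : z ∈ e.target) (hz' : e.symm z ∈ e'.source)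
    (hz'' : e.symm z ∈ e''.source) :
    fderiv ℝ (fun w => e'' (e.symm w)) z =
      (fderiv ℝ (fun w => e'' (e'.symm w)) (e' (e.symm z))).comp
        (fderiv ℝ (fun w => e' (e.symm w)) z) := by
  rw [(transition_comp_eventuallyEq hz hz').fderiv_eq]
  refine fderiv_comp z ?_ (differentiableAt_transition he he' hz hz')
  exact differentiableAt_transition he' he'' (e'.map_source hz') (by rwa [e'.left_inv hz'])

lemma jacobian_comp (he : e ∈ atlas C2 S) (he' : e' ∈ atlas C2 S)
    (he'' : e'' ∈ atlas C2 S) (hz : z ∈ e.target) (hz' : e.symm z ∈ e'.source)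
    (hz'' : e.symm z ∈ e''.source) :
    jacobian e e'' z = jacobian e' e'' (e' (e.symm z)) * jacobian e e' z := by
  have h1 : DifferentiableAt ℂ (fun w => e' (e.symm w)) z :=
    (contDiffAt_transition he he' hz hz').differentiableAt (by simp)
  have h2 : DifferentiableAt ℂ (fun w => e'' (e'.symm w)) (e' (e.symm z)) :=
    (contDiffAt_transition he' he'' (e'.map_source hz')
      (by rwa [e'.left_inv hz'])).differentiableAt (by simp)
  ext i j
  simp only [jacobian, Matrix.mul_apply]
  rw [(transition_comp_eventuallyEq hz hz').fderiv_eq, fderiv_comp z h2 h1,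
    ContinuousLinearMap.comp_apply]
  conv_lhs => rw [pi_eq_sum_univ' (fderiv ℂ (fun w => e' (e.symm w)) z (Pi.single j 1))]
  simp only [map_sum, map_smul, Finset.sum_apply, Pi.smul_apply, smul_eq_mul]
  refine Finset.sum_congr rfl fun k _ => ?_
  rw [mul_comm]

/-- The chain rule for `e → e' → e` exhibits this determinant as a factor of one. -/
lemma det_jacobian_ne_zero (he : e ∈ atlas C2 S) (he' : e' ∈ atlas C2 S) (hz : z ∈ e.target)
    (hz' : e.symm z ∈ e'.source) : (jacobian e e' z).det ≠ 0 := by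
  have h := congrArg Matrix.det
    (jacobian_comp he he' he hz hz' (e.map_target hz))
  rw [jacobian_self hz, Matrix.det_one, Matrix.det_mul] at h
  exact right_ne_zero_of_mul (h ▸ one_ne_zero)

lemma contDiffAt_jacobian (he : e ∈ atlas C2 S) (he' : e' ∈ atlas C2 S) (hz : z ∈ e.target)
    (hz' : e.symm z ∈ e'.source) (i j : Fin 2) :
    ContDiffAt ℝ ∞ (fun w => jacobian e e' w i j) z := by
  have h : ContDiffAt ℂ ∞ (fun w => fderiv ℂ (fun w => e' (e.symm w)) w) z :=
    (contDiffAt_transition he he' hz hz').fderiv_right (by simp)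
  have h1 := (h.clm_apply (contDiffAt_const (c := Pi.single j 1))).restrict_scalars ℝ
  exact contDiffAt_pi.1 h1 i

lemma contDiffAt_det_jacobian (he : e ∈ atlas C2 S) (he' : e' ∈ atlas C2 S) (hz : z ∈ e.target)
    (hz' : e.symm z ∈ e'.source) :
    ContDiffAt ℝ ∞ (fun w => (jacobian e e' w).det) z := by
  have h := contDiffAt_jacobian he he' hz hz'
  simp only [Matrix.det_fin_two]
  exact ((h 0 0).mul (h 1 1)).sub ((h 0 1).mul (h 1 0))

end Transition

/-! ### The first Chern form of a connection. -/

section ChernClass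

variable {S : Type} [TopologicalSpace S] [ChartedSpace C2 S]

/-- The `1`-form `(i / 2π) tr θ`, a primitive of the first Chern form in a chart. -/
def TangentConnection.chernPrimitive (D : TangentConnection S)
    (e : OpenPartialHomeomorph S C2) (z : C2) : C2 [⋀^Fin 1]→L[ℝ] ℂ :=
  (Complex.I / (2 * Real.pi)) • (D.θ e 0 0 z + D.θ e 1 1 z)

lemma TangentConnection.contDiffOn_chernPrimitive (D : TangentConnection S)
    {e : OpenPartialHomeomorph S C2} (he : e ∈ atlas C2 S) :
    ContDiffOn ℝ ∞ (D.chernPrimitive e) e.target :=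
  ((D.smooth e he 0 0).add (D.smooth e he 1 1)).const_smul (Complex.I / (2 * Real.pi))

lemma TangentConnection.contDiffAt_chernPrimitive (D : TangentConnection S)
    {e : OpenPartialHomeomorph S C2} (he : e ∈ atlas C2 S) {z : C2} (hz : z ∈ e.target) :
    ContDiffAt ℝ ∞ (D.chernPrimitive e) z :=
  (D.contDiffOn_chernPrimitive he).contDiffAt (e.open_target.mem_nhds hz)

lemma fderiv_det_fin_two {A : C2 → Matrix (Fin 2) (Fin 2) ℂ} {z : C2}
    (h : ∀ i j, DifferentiableAt ℝ (fun w => A w i j) z) (v : C2) :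
    fderiv ℝ (fun w => (A w).det) z v =
      A z 0 0 * fderiv ℝ (fun w => A w 1 1) z v + A z 1 1 * fderiv ℝ (fun w => A w 0 0) z v
      - (A z 0 1 * fderiv ℝ (fun w => A w 1 0) z v
        + A z 1 0 * fderiv ℝ (fun w => A w 0 1) z v) := by
  have h' := fun i j => (h i j).hasFDerivAt
  have h1 := (((h' 0 0).mul (h' 1 1)).sub ((h' 0 1).mul (h' 1 0))).fderiv
  have h2 := congrArg (fun L : C2 →L[ℝ] ℂ => L v) h1
  simp only [Matrix.det_fin_two]
  refine Eq.trans h2 ?_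
  simp

variable [IsManifold 𝓘(ℂ, C2) ω S] (D : TangentConnection S)
  {e e' e'' : OpenPartialHomeomorph S C2} {z : C2}

/-- The trace of `θ = J⁻¹ dJ + J⁻¹ θ' J` is `tr θ = d log det J + tr θ'`. -/
lemma TangentConnection.chernPrimitive_transform (he : e ∈ atlas C2 S) (he' : e' ∈ atlas C2 S)
    (hz : z ∈ e.target) (hz' : e.symm z ∈ e'.source) (v : C2) :
    D.chernPrimitive e z ![v] =
      Complex.I / (2 * Real.pi) *
          (fderiv ℝ (fun w => (jacobian e e' w).det) z v / (jacobian e e' z).det)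
        + D.chernPrimitive e' (e' (e.symm z)) ![fderiv ℝ (fun w => e' (e.symm w)) z v] := by
  have hd := det_jacobian_ne_zero he he' hz hz'
  have h := D.transform e he e' he' z hz hz'
  have h00 := h 0 0 v
  have h01 := h 0 1 v
  have h10 := h 1 0 v
  have h11 := h 1 1 v
  have hdet := fderiv_det_fin_two
    (fun i j => (contDiffAt_jacobian he he' hz hz' i j).differentiableAt (by simp)) v
  simp only [Fin.sum_univ_two] at h00 h01 h10 h11
  simp only [chernPrimitive, ContinuousAlternatingMap.smul_apply,
    ContinuousAlternatingMap.add_apply, smul_eq_mul]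
  rw [← mul_add]
  congr 1
  rw [hdet]
  rw [Matrix.det_fin_two] at hd ⊢
  rw [← sub_eq_iff_eq_add, eq_div_iff hd]
  -- The coefficients are the entries of the adjugate of `J`: this is the trace of `adj J` times the
  -- transformation law.
  linear_combination jacobian e e' z 1 1 * h00 - jacobian e e' z 0 1 * h10
    - jacobian e e' z 1 0 * h01 + jacobian e e' z 0 0 * h11


/-- Division by `c` moves the branch cut away from the value of `g`, so this function is a smooth
local branch of `log g`. -/
lemma contDiffAt_log_add {g : C2 → ℂ} (hg : ContDiffAt ℝ ∞ g z) {c : ℂ}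
    (hc : g z / c ∈ Complex.slitPlane) :
    ContDiffAt ℝ ∞ (fun w => Complex.log (g w / c) + Complex.log c) z := by
  have h : ContDiffAt ℝ ∞ Complex.log (g z / c) := (Complex.contDiffAt_log hc).restrict_scalars ℝ
  exact (h.comp z (hg.div_const c)).add contDiffAt_const

lemma fderiv_log_add {g : C2 → ℂ} (hg : ContDiffAt ℝ ∞ g z) {c : ℂ}
    (hc : g z / c ∈ Complex.slitPlane) (v : C2) :
    fderiv ℝ (fun w => Complex.log (g w / c) + Complex.log c) z v = fderiv ℝ g z v / g z := by
  have hc0 : c ≠ 0 := by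
    rintro rfl
    simp at hc
  have hg0 : g z ≠ 0 := by
    intro h
    simp [h] at hc
  have h1 : HasFDerivAt g (fderiv ℝ g z) z := (hg.differentiableAt (by simp)).hasFDerivAt
  have h2 : HasDerivAt (fun x : ℂ => Complex.log (x / c) + Complex.log c) (g z)⁻¹ (g z) := by
    have h3 := (((hasDerivAt_id (g z)).div_const c).clog hc).add_const (Complex.log c)
    have h4 : 1 / c / (g z / c) = (g z)⁻¹ := by field_simp
    exact h4 ▸ h3
  have h4 := (h2.hasFDerivAt.restrictScalars ℝ).comp z h1
  refine (congrArg (fun L : C2 →L[ℝ] ℂ => L v) h4.fderiv).trans ?_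
  simp [div_eq_mul_inv]

/-- The pull-back of a `1`-form given in one chart. -/
def DForm.ofChart {e₀ : OpenPartialHomeomorph S C2} (he₀ : e₀ ∈ atlas C2 S)
    {β : C2 → C2 [⋀^Fin 1]→L[ℝ] ℂ} (hβ : ContDiffOn ℝ ∞ β e₀.target) {W : Set S}
    (hW : W ⊆ e₀.source) : DForm S 1 W where
  toFun e z := (β (e₀ (e.symm z))).compContinuousLinearMap
    (fderiv ℝ (fun w => e₀ (e.symm w)) z)
  smooth e he := by
    rintro z ⟨hz, hz'⟩
    have h0 := contDiffAt_transition_real he he₀ hz (hW hz')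
    have h1 : ContDiffAt ℝ ∞ (fderiv ℝ (fun w => e₀ (e.symm w))) z := h0.fderiv_right (by simp)
    have h2 : ContDiffAt ℝ ∞ (fun w => β (e₀ (e.symm w))) z :=
      (hβ.contDiffAt (e₀.open_target.mem_nhds (e₀.map_source (hW hz')))).comp z
        (h0.of_le (by simp))
    let l := ContinuousAlternatingMap.ofSubsingletonLIE (𝕜 := ℝ) (E := C2) (F := ℂ) (0 : Fin 1)
    have h3 : ContDiffAt ℝ ∞ (fun w => l.symm (β (e₀ (e.symm w)))) z :=
      l.symm.contDiff.contDiffAt.comp z h2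
    have h4 : ContDiffAt ℝ ∞ (fun w => l ((l.symm (β (e₀ (e.symm w)))).comp
        (fderiv ℝ (fun w => e₀ (e.symm w)) w))) z :=
      l.contDiff.contDiffAt.comp z (h3.clm_comp h1)
    refine (h4.congr_of_eventuallyEq (Filter.Eventually.of_forall fun w => ?_)).contDiffWithinAt
    ext v
    simp only [ContinuousAlternatingMap.compContinuousLinearMap_apply]
    change _ = (β (e₀ (e.symm w))) _
    congr 1
    ext i
    fin_cases i
    rfl
  compat e he e' he' z hz hz' hzW := by
    rw [fderiv_transition_comp he he' he₀ hz hz' (hW hzW), e'.left_inv hz']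
    rfl

/-- The first Chern form. -/
def TangentConnection.chernDForm : DForm S 2 Set.univ where
  toFun e := extDeriv (D.chernPrimitive e)
  smooth e he := by
    refine ContDiffOn.mono ?_ Set.inter_subset_left
    exact (ContinuousAlternatingMap.alternatizeUncurryFinCLM ℝ C2 ℂ).contDiff.comp_contDiffOn
      ((D.contDiffOn_chernPrimitive he).fderiv_of_isOpen (m := ∞)
        e.open_target le_rfl)
  compat e he e' he' z hz hz' _ := by
    -- Near `z` the primitive of `e` is the pull-back of that of `e'` plus the exact form `df`,
    -- where `f` is `i / 2π` times a branch of `log det J`. As `d² = 0`, the exterior derivatives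
    -- correspond.
    set g : C2 → ℂ := fun w => (jacobian e e' w).det with hg
    have hslit : g z / g z ∈ Complex.slitPlane := by
      rw [div_self (det_jacobian_ne_zero he he' hz hz')]
      exact Complex.one_mem_slitPlane
    have hgs := contDiffAt_det_jacobian he he' hz hz'
    set f : C2 → ℂ := fun w => Complex.I / (2 * Real.pi) *
      (Complex.log (g w / g z) + Complex.log (g z)) with hf
    have hfs : ContDiffAt ℝ ∞ f z := contDiffAt_const.mul (contDiffAt_log_add hgs hslit)
    have hfs' : ContDiffAt ℝ ∞
        (fun w => ContinuousAlternatingMap.constOfIsEmpty ℝ C2 (Fin 0) (f w)) z :=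
      (ContinuousAlternatingMap.constOfIsEmptyLIE ℝ C2 ℂ (Fin 0)).contDiff.contDiffAt.comp z hfs
    have hT := contDiffAt_transition_real he he' hz hz'
    have hβ := D.contDiffAt_chernPrimitive he' (e'.map_source hz')
    have hev : D.chernPrimitive e =ᶠ[𝓝 z]
        fun w => extDeriv (fun w => ContinuousAlternatingMap.constOfIsEmpty ℝ C2 (Fin 0) (f w)) w
          + (D.chernPrimitive e' (e' (e.symm w))).compContinuousLinearMap
            (fderiv ℝ (fun w => e' (e.symm w)) w) := by
      have hsl : ∀ᶠ w in 𝓝 z, g w / g z ∈ Complex.slitPlane :=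
        ((hgs.continuousAt.div_const (g z)).eventually
          (Complex.isOpen_slitPlane.mem_nhds hslit))
      filter_upwards [eventually_mem_target hz, eventually_symm_mem e'.open_source hz hz', hsl]
        with w hw hw' hwsl
      have hgw := contDiffAt_det_jacobian he he' hw hw'
      rw [extDeriv_constOfIsEmpty]
      ext v
      have hv : v = ![v 0] := by
        ext i
        fin_cases i
        rfl
      have hfd : fderiv ℝ f w (v 0) = Complex.I / (2 * Real.pi) * (fderiv ℝ g w (v 0) / g w) := by
        rw [← fderiv_log_add hgw hwsl, hf,
          fderiv_const_mul ((contDiffAt_log_add hgw hwsl).differentiableAt (by simp))]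
        simp
      rw [hv, D.chernPrimitive_transform he he' hw hw' (v 0), ContinuousAlternatingMap.add_apply,
        ContinuousAlternatingMap.ofSubsingleton_apply_apply,
        ContinuousAlternatingMap.compContinuousLinearMap_apply]
      congr 1
      · exact hfd.symm
      · congr 1
        ext i
        fin_cases i
        rfl
    rw [hev.extDeriv_eq, extDeriv_fun_add, extDeriv_extDeriv_apply hfs' minSmoothness_two_le, zero_add]
    · exact extDeriv_pullback (hβ.differentiableAt (by simp)) hT (by simp)
    · have h : ContDiffAt ℝ ∞ (fderiv ℝ
          (fun w => ContinuousAlternatingMap.constOfIsEmpty ℝ C2 (Fin 0) (f w))) z :=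
        hfs'.fderiv_right (by simp)
      exact ((ContinuousAlternatingMap.alternatizeUncurryFinCLM ℝ C2
        ℂ).contDiff.contDiffAt.comp z h).differentiableAt (by simp)
    · have h := (DForm.ofChart he' (D.contDiffOn_chernPrimitive he') subset_rfl).smooth e he
      exact (h.contDiffAt ((e.isOpen_inter_preimage_symm e'.open_source).mem_nhds
        ⟨hz, hz'⟩)).differentiableAt (by simp)

lemma TangentConnection.isClosed_chernDForm : D.chernDForm.IsClosed := fun _ he _ hz =>
  extDeriv_extDeriv_apply (D.contDiffAt_chernPrimitive he hz) minSmoothness_two_le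

end ChernClass
end ToricSurf

/-! ### Rationality of the first Chern class. -/

namespace ToricSurf

open Topology

/-- A compact Hausdorff space has an open cover that refines a given one and on whose double
intersections the given nonvanishing functions have logarithms. -/
lemma exists_cover_mem_slitPlane {S J : Type} [TopologicalSpace S] [CompactSpace S] [T2Space S]
    (U : J → Set S) (hU : ∀ j, IsOpen (U j)) (hcover : ∀ x, ∃ j, x ∈ U j) (g : J → J → S → ℂ)
    (hg : ∀ i j, ContinuousOn (g i j) (U i ∩ U j)) (hne : ∀ i j, ∀ x ∈ U i ∩ U j, g i j x ≠ 0) :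
    ∃ (W : S → Set S) (idx : S → J) (c : S → S → ℂ), (∀ a, IsOpen (W a)) ∧ (∀ a, a ∈ W a) ∧
      (∀ a, W a ⊆ U (idx a)) ∧
      ∀ a b, ∀ x ∈ W a ∩ W b, g (idx a) (idx b) x / c a b ∈ Complex.slitPlane := by
  choose i hi using hcover
  have hK : ∀ p, ∃ K ∈ 𝓝 p, K ⊆ U (i p) ∧ IsCompact K := fun p =>
    local_compact_nhds ((hU _).mem_nhds (hi p))
  choose K hKn hKU hKc using hK
  obtain ⟨t, ht⟩ := CompactSpace.elim_nhds_subcover (fun p => interior (K p))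
    fun p => interior_mem_nhds.2 (hKn p)
  have hp : ∀ x, ∃ p ∈ t, x ∈ interior (K p) := fun x => by
    have hx : x ∈ ⋃ p ∈ t, interior (K p) := ht ▸ Set.mem_univ x
    simpa using hx
  choose p hpt hpx using hp
  -- Only the finitely many charts indexed by `t` are used, so one neighbourhood of `x` serves for
  -- all of them. If `x ∉ K q`, a neighbourhood avoids the closed set `K q`; otherwise continuity
  -- keeps the quotient by the value at `x` close to one.
  have hev : ∀ x, ∀ᶠ y in 𝓝 x, y ∈ interior (K (p x)) ∧ ∀ q ∈ t, y ∈ K q →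
      g (i (p x)) (i q) y / g (i (p x)) (i q) x ∈ Complex.slitPlane := by
    intro x
    refine (isOpen_interior.eventually_mem (hpx x)).and ?_
    refine (Filter.eventually_all_finset t).2 fun q _ => ?_
    by_cases hxq : x ∈ K q
    · have hx : x ∈ U (i (p x)) ∩ U (i q) := ⟨hKU _ (interior_subset (hpx x)), hKU _ hxq⟩
      have hc : ContinuousAt (g (i (p x)) (i q)) x :=
        (hg _ _).continuousAt (((hU _).inter (hU _)).mem_nhds hx)
      have hs : g (i (p x)) (i q) x / g (i (p x)) (i q) x ∈ Complex.slitPlane := by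
        rw [div_self (hne _ _ x hx)]
        exact Complex.one_mem_slitPlane
      filter_upwards [(hc.div_const _).eventually (Complex.isOpen_slitPlane.mem_nhds hs)]
        with y hy _ using hy
    · filter_upwards [(hKc q).isClosed.isOpen_compl.mem_nhds hxq] with y hy hy' using absurd hy' hy
  have hW : ∀ x, ∃ W : Set S, (∀ y ∈ W, y ∈ interior (K (p x)) ∧ ∀ q ∈ t, y ∈ K q →
      g (i (p x)) (i q) y / g (i (p x)) (i q) x ∈ Complex.slitPlane) ∧ IsOpen W ∧ x ∈ W :=
    fun x => eventually_nhds_iff.1 (hev x)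
  choose W hWP hWo hWx using hW
  refine ⟨W, fun x => i (p x), fun a b => g (i (p a)) (i (p b)) a, hWo, hWx,
    fun a x hx => hKU _ (interior_subset (hWP a x hx).1), ?_⟩
  rintro a b x ⟨ha, hb⟩
  exact (hWP a x ha).2 _ (hpt b) (interior_subset (hWP b x hb).1)

variable {S : Type} [TopologicalSpace S] [ChartedSpace C2 S] [IsManifold 𝓘(ℂ, C2) ω S]

lemma extDeriv_ofChart {e₀ e : OpenPartialHomeomorph S C2} (he₀ : e₀ ∈ atlas C2 S)
    (he : e ∈ atlas C2 S)
    {β : C2 → C2 [⋀^Fin 1]→L[ℝ] ℂ} (hβ : ContDiffOn ℝ ∞ β e₀.target) {W : Set S}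
    (hW : W ⊆ e₀.source) {z : C2} (hz : z ∈ e.target) (hz' : e.symm z ∈ e₀.source) :
    extDeriv ((DForm.ofChart he₀ hβ hW).toFun e) z =
      (extDeriv β (e₀ (e.symm z))).compContinuousLinearMap
        (fderiv ℝ (fun w => e₀ (e.symm w)) z) := by
  refine extDeriv_pullback ?_ (contDiffAt_transition_real he he₀ hz hz') (by simp)
  exact (hβ.contDiffAt (e₀.open_target.mem_nhds (e₀.map_source hz'))).differentiableAt (by simp)

/-- The first Chern form represents a rational (in fact integral) cohomology class. -/
theorem TangentConnection.isRational_chernDForm [CompactSpace S] [T2Space S]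
    (D : TangentConnection S) : D.chernDForm.IsRational := by
  have hA : ∀ p : S, chartAt C2 p ∈ atlas C2 S := fun p => chart_mem_atlas C2 p
  obtain ⟨W, idx, c, hWo, hWx, hWU, hc⟩ := exists_cover_mem_slitPlane
    (fun p : S => (chartAt C2 p).source) (fun p => (chartAt C2 p).open_source)
    (fun x => ⟨x, mem_chart_source C2 x⟩)
    (fun p q x => (jacobian (chartAt C2 p) (chartAt C2 q) (chartAt C2 p x)).det)
    (by
      rintro p q x ⟨hx, hx'⟩
      have h := (contDiffAt_det_jacobian (hA p) (hA q) ((chartAt C2 p).map_source hx)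
        (by rwa [(chartAt C2 p).left_inv hx])).continuousAt
      exact (ContinuousAt.comp (f := chartAt C2 p) h
        ((chartAt C2 p).continuousAt hx)).continuousWithinAt)
    (by
      rintro p q x ⟨hx, hx'⟩
      exact det_jacobian_ne_zero (hA p) (hA q) ((chartAt C2 p).map_source hx)
        (by rwa [(chartAt C2 p).left_inv hx]))
  set E : S → OpenPartialHomeomorph S C2 := fun a => chartAt C2 (idx a) with hE
  have hEA : ∀ a, E a ∈ atlas C2 S := fun a => hA _
  set L : S → S → C2 → ℂ := fun a b y =>
    Complex.log ((jacobian (E a) (E b) y).det / c a b) + Complex.log (c a b) with hL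
  set κ : ℂ := Complex.I / (2 * Real.pi) with hκ
  have hexp : ∀ a b, ∀ x ∈ W a ∩ W b,
      Complex.exp (L a b (E a x)) = (jacobian (E a) (E b) (E a x)).det := by
    intro a b x hx
    have h := hc a b x hx
    have hc0 : c a b ≠ 0 := by
      intro h0
      simp [h0] at h
    rw [hL]
    simp only
    rw [Complex.exp_add, Complex.exp_log (Complex.slitPlane_ne_zero h), Complex.exp_log hc0,
      div_mul_cancel₀ _ hc0]
  have hLs : ∀ a b, ∀ x ∈ W a ∩ W b, ContDiffAt ℝ ∞ (L a b) (E a x) := by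
    rintro a b x ⟨hxa, hxb⟩
    refine contDiffAt_log_add (contDiffAt_det_jacobian (hEA a) (hEA b)
      ((E a).map_source (hWU a hxa)) ?_) (hc a b x ⟨hxa, hxb⟩)
    rw [(E a).left_inv (hWU a hxa)]
    exact hWU b hxb
  -- The sign comes from `chernPrimitive_transform`: `A b - A a = -κ d log det J` for the Jacobian
  -- `J` from `E a` to `E b`.
  refine ⟨S, W, fun a => DForm.ofChart (hEA a) (D.contDiffOn_chernPrimitive (hEA a)) (hWU a),
    fun a b x => -(κ * L a b (E a x)), hWo,
    Set.eq_univ_of_forall fun x => Set.mem_iUnion.2 ⟨x, hWx x⟩, ?_, ?_, ?_, ?_⟩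
  · intro a e he z hz hza
    rw [extDeriv_ofChart _ he _ _ hz (hWU a hza)]
    exact (D.chernDForm.compat e he _ (hEA a) z hz (hWU a hza) (Set.mem_univ _)).symm
  · rintro a b e he z ⟨hz, hzW⟩
    have hT := (contDiffAt_transition_real he (hEA a) hz (hWU a hzW.1)).of_le (n := ω) (m := ∞)
      le_top
    have h := (hLs a b _ hzW).comp z hT
    exact (contDiffAt_const.mul h).neg.contDiffWithinAt
  · intro a b e he z hz hzW v
    have hza := hWU a hzW.1
    have hzb := hWU b hzW.2
    have hT := differentiableAt_transition he (hEA a) hz hza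
    have hLd := (hLs a b _ hzW).differentiableAt (by simp)
    have h1 : HasFDerivAt (fun w => -(κ * L a b (E a (e.symm w))))
        (-(κ • (fderiv ℝ (L a b) (E a (e.symm z))).comp
          (fderiv ℝ (fun w => E a (e.symm w)) z))) z :=
      ((hLd.hasFDerivAt.comp z hT.hasFDerivAt).const_mul κ).neg
    have hay : E a (e.symm z) ∈ (E a).target := (E a).map_source hza
    have hyb : (E a).symm (E a (e.symm z)) ∈ (E b).source := by
      rw [(E a).left_inv hza]
      exact hzb
    have h2 := D.chernPrimitive_transform (hEA a) (hEA b) hay hyb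
      (fderiv ℝ (fun w => E a (e.symm w)) z v)
    have h3 := fderiv_log_add (contDiffAt_det_jacobian (hEA a) (hEA b) hay hyb) (hc a b _ hzW)
      (fderiv ℝ (fun w => E a (e.symm w)) z v)
    have h4 : ∀ d, (DForm.ofChart (hEA d) (D.contDiffOn_chernPrimitive (hEA d)) (hWU d)).toFun e z
        ![v] = D.chernPrimitive (E d) (E d (e.symm z)) ![fderiv ℝ (fun w => E d (e.symm w)) z v] := by
      intro d
      simp only [DForm.ofChart, ContinuousAlternatingMap.compContinuousLinearMap_apply]
      congr 1
      ext i
      fin_cases i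
      rfl
    rw [h1.fderiv, h4, h4, h2, ← h3, (E a).left_inv hza,
      fderiv_transition_comp he (hEA a) (hEA b) hz hza hzb]
    simp [hL, hκ]
  · rintro a b d x ⟨⟨hxa, hxb⟩, hxd⟩
    -- Jacobian determinants multiply, so the chosen logarithms add up to within `2πi n`; multiplied
    -- by `κ = i / 2π` this is an integer.
    have hJ := congrArg Matrix.det (jacobian_comp (hEA a) (hEA b) (hEA d)
      ((E a).map_source (hWU a hxa)) (by rw [(E a).left_inv (hWU a hxa)]; exact hWU b hxb)
      (by rw [(E a).left_inv (hWU a hxa)]; exact hWU d hxd))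
    rw [Matrix.det_mul, (E a).left_inv (hWU a hxa), ← hexp a b x ⟨hxa, hxb⟩,
      ← hexp b d x ⟨hxb, hxd⟩, ← hexp a d x ⟨hxa, hxd⟩, ← Complex.exp_add,
      Complex.exp_eq_exp_iff_exists_int] at hJ
    obtain ⟨n, hn⟩ := hJ
    refine ⟨-n, ?_⟩
    have hpi : (Real.pi : ℂ) ≠ 0 := by simp [Real.pi_ne_zero]
    beta_reduce
    rw [hn, hκ]
    push_cast
    field_simp
    linear_combination 2 * (Real.pi : ℂ) * n * Complex.I_sq

/-! ### Multiples of rational classes by locally constant rational functions. -/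

omit [ChartedSpace C2 S] [IsManifold 𝓘(ℂ, C2) ω S] in
lemma eventually_eq_of_isLocallyConstant {a : S → ℚ} (ha : IsLocallyConstant a)
    {e : OpenPartialHomeomorph S C2} {z : C2} (hz : z ∈ e.target) :
    ∀ᶠ w in 𝓝 z, a (e.symm w) = a (e.symm z) :=
  eventually_symm_mem (U := a ⁻¹' {a (e.symm z)}) (ha.isOpen_fiber _) hz rfl

omit [IsManifold 𝓘(ℂ, C2) ω S] in
/-- The multiple of a form by a locally constant rational function. -/
def DForm.smul {k : ℕ} {W : Set S} (α : DForm S k W) {a : S → ℚ} (ha : IsLocallyConstant a) :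
    DForm S k W where
  toFun e z := (a (e.symm z) : ℝ) • α.toFun e z
  smooth e he z hz := by
    refine ((α.smooth e he z hz).const_smul (a (e.symm z) : ℝ)).congr_of_eventuallyEq ?_ rfl
    filter_upwards [(eventually_eq_of_isLocallyConstant ha hz.1).filter_mono nhdsWithin_le_nhds]
      with w hw
    rw [hw]
  compat e he e' he' z hz hz' hzW := by
    rw [e'.left_inv hz', α.compat e he e' he' z hz hz' hzW]
    rfl

omit [IsManifold 𝓘(ℂ, C2) ω S] in
lemma DForm.extDeriv_smul {k : ℕ} {W : Set S} (α : DForm S k W) {a : S → ℚ}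
    (ha : IsLocallyConstant a) {e : OpenPartialHomeomorph S C2} {z : C2} (hz : z ∈ e.target) :
    extDeriv ((α.smul ha).toFun e) z = (a (e.symm z) : ℝ) • extDeriv (α.toFun e) z := by
  have h : (α.smul ha).toFun e =ᶠ[𝓝 z] (a (e.symm z) : ℝ) • α.toFun e := by
    filter_upwards [eventually_eq_of_isLocallyConstant ha hz] with w hw
    simp only [DForm.smul, hw, Pi.smul_apply]
  rw [h.extDeriv_eq, _root_.extDeriv_smul]

omit [IsManifold 𝓘(ℂ, C2) ω S] in
/-- The multiple of a rational class by a locally constant rational function. -/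
def RationalClass.smul (R : RationalClass S) {a : S → ℚ} (ha : IsLocallyConstant a) :
    RationalClass S where
  form := R.form.smul ha
  closed e he z hz := by rw [R.form.extDeriv_smul ha hz, R.closed e he z hz, smul_zero]
  rational := by
    obtain ⟨ι, W, A, f, hWo, hWc, hA, hfs, hfd, hf⟩ := R.rational
    refine ⟨ι, W, fun i => (A i).smul ha, fun i j x => (a x : ℝ) • f i j x, hWo, hWc, ?_, ?_, ?_, ?_⟩
    · intro i e he z hz hzW
      rw [(A i).extDeriv_smul ha hz, hA i e he z hz hzW]
      rfl
    · intro i j e he z hz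
      refine ((hfs i j e he z hz).const_smul (a (e.symm z) : ℝ)).congr_of_eventuallyEq ?_ rfl
      filter_upwards [(eventually_eq_of_isLocallyConstant ha hz.1).filter_mono nhdsWithin_le_nhds]
        with w hw
      rw [hw]
    · intro i j e he z hz hzW v
      have h : (fun w => (a (e.symm w) : ℝ) • f i j (e.symm w)) =ᶠ[𝓝 z]
          (a (e.symm z) : ℝ) • fun w => f i j (e.symm w) := by
        filter_upwards [eventually_eq_of_isLocallyConstant ha hz] with w hw
        simp only [hw, Pi.smul_apply]
      rw [h.fderiv_eq, fderiv_const_smul_field]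
      simp only [DForm.smul, ContinuousAlternatingMap.smul_apply, _root_.smul_apply,
        Pi.smul_apply]
      rw [hfd i j e he z hz hzW v, smul_sub]
    · intro i j k x hx
      obtain ⟨r, hr⟩ := hf i j k x hx
      refine ⟨a x * r, ?_⟩
      rw [← smul_add, ← smul_sub, hr]
      simp

/-- The first Chern class. -/
def TangentConnection.chernClass [CompactSpace S] [T2Space S] (D : TangentConnection S) :
    RationalClass S :=
  ⟨D.chernDForm, D.isClosed_chernDForm, D.isRational_chernDForm⟩

end ToricSurf

namespace ToricSurf

open Topology MeasureTheory

/-! ### Connections and integrals on disjoint unions -/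

lemma volume_coord_eq_zero (l : Fin 2) : volume {z : C2 | z l = 0} = 0 := by
  have h := Measure.addHaar_submodule (volume : Measure C2)
    (LinearMap.ker ((LinearMap.proj l : C2 →ₗ[ℂ] ℂ).restrictScalars ℝ)) (by
      intro h
      have h1 : (1 : C2) ∈ LinearMap.ker ((LinearMap.proj l : C2 →ₗ[ℂ] ℂ).restrictScalars ℝ) :=
        h ▸ Submodule.mem_top
      simp at h1)
  exact h

lemma clm_apply_eq_sum {F : Type*} [NormedAddCommGroup F] [NormedSpace ℂ F] (L : C2 →L[ℂ] F)
    (v : C2) : L v = ∑ c, v c • L (Pi.single c 1) := by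
  conv_lhs => rw [pi_eq_sum_univ' v]
  simp only [map_sum, map_smul]

/-- The complex linear `1`-form with the given components, as a real alternating map. -/
def oneForm (φ : Fin 2 → ℂ) : C2 [⋀^Fin 1]→L[ℝ] ℂ :=
  ContinuousAlternatingMap.ofSubsingletonLIE (𝕜 := ℝ) (E := C2) (F := ℂ) (0 : Fin 1)
    (∑ c, φ c • (ContinuousLinearMap.proj c : C2 →L[ℝ] ℂ))

@[simp] lemma oneForm_apply (φ : Fin 2 → ℂ) (v : Fin 1 → C2) :
    oneForm φ v = ∑ c, φ c * v 0 c := by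
  simp [oneForm]

lemma contDiff_oneForm {φ : Fin 2 → C2 → ℂ} (h : ∀ c, ContDiff ℝ ∞ (φ c)) :
    ContDiff ℝ ∞ fun z => oneForm fun c => φ c z := by
  refine (LinearIsometryEquiv.contDiff _).comp ?_
  exact ContDiff.sum fun c _ => (h c).smul contDiff_const

lemma extDeriv_oneForm {φ : Fin 2 → C2 → ℂ} (h : ∀ c, ContDiff ℝ ∞ (φ c)) (z u v : C2) :
    extDeriv (fun z => oneForm fun c => φ c z) z ![u, v] =
      ∑ c, (fderiv ℝ (φ c) z u * v c - fderiv ℝ (φ c) z v * u c) := by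
  have hd : ∀ c, DifferentiableAt ℝ (φ c) z := fun c =>
    (h c).contDiffAt.differentiableAt (by simp)
  have h1 : ∀ v : C2, fderiv ℝ (fun w => ∑ c, φ c w * v c) z =
      ∑ c, v c • fderiv ℝ (φ c) z := by
    intro v
    rw [fderiv_fun_sum fun c _ => (hd c).mul_const (v c)]
    exact Finset.sum_congr rfl fun c _ => fderiv_mul_const (hd c) (v c)
  rw [extDeriv_apply ((contDiff_oneForm h).contDiffAt.differentiableAt (by simp))]
  have e0 : (fun w => oneForm (fun c => φ c w) (Fin.removeNth 0 ![u, v])) =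
      fun w => ∑ c, φ c w * v c := by
    ext w
    simp
  have e1 : (fun w => oneForm (fun c => φ c w) (Fin.removeNth 1 ![u, v])) =
      fun w => ∑ c, φ c w * u c := by
    ext w
    simp [Fin.removeNth]
  rw [Fin.sum_univ_two, e0, e1, h1, h1]
  simp
  ring

/-! ### Connections given by Christoffel symbols. -/

namespace MonomialAtlas

/-- The Jacobian matrix of a change of coordinates. -/
def jac (M : MonomialAtlas) (i j : M.ι) (z : C2) : Matrix (Fin 2) (Fin 2) ℂ :=
  fun a b => fderiv ℂ (M.trans i j) z (Pi.single b 1) a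

/-- A connection of type `(1, 0)` on the tangent bundle, given by its Christoffel symbols
`Γ a b c`, which are the same functions in all the affine charts. -/
structure Christoffel (M : MonomialAtlas) where
  Γ : Fin 2 → Fin 2 → Fin 2 → C2 → ℂ
  smooth : ∀ a b c, ContDiff ℝ ∞ (Γ a b c)
  transform : ∀ i j z, M.hom i z j ≠ 0 → ∀ a b c,
    ∑ k, M.jac i j z a k * Γ k b c z =
      fderiv ℂ (fun w => M.jac i j w a b) z (Pi.single c 1) +
        ∑ k, ∑ l, Γ a k l (M.trans i j z) * M.jac i j z l c * M.jac i j z k b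

/-- The curvature of a connection given by Christoffel symbols. -/
def Christoffel.curvature {M : MonomialAtlas} (G : M.Christoffel) (z : C2) (a b : Fin 2)
    (u v : C2) : ℂ :=
  ∑ c, (fderiv ℝ (G.Γ a b c) z u * v c - fderiv ℝ (G.Γ a b c) z v * u c) +
    ∑ k, ((∑ c, G.Γ a k c z * u c) * (∑ c, G.Γ k b c z * v c) -
      (∑ c, G.Γ a k c z * v c) * (∑ c, G.Γ k b c z * u c))

lemma isOpen_hom_ne_zero (M : MonomialAtlas) (i j : M.ι) : IsOpen {z | M.hom i z j ≠ 0} :=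
  isOpen_ne.preimage (M.continuous_hom i j)

lemma contDiffAt_trans (M : MonomialAtlas) (i j : M.ι) {z : C2} (h : M.hom i z j ≠ 0) :
    ContDiffAt ℂ ω (M.trans i j) z :=
  (M.contDiffOn_trans i j).contDiffAt ((M.isOpen_hom_ne_zero i j).mem_nhds h)

lemma contDiffAt_jac (M : MonomialAtlas) (i j : M.ι) {z : C2} (h : M.hom i z j ≠ 0)
    (a b : Fin 2) : ContDiffAt ℂ ω (fun w => M.jac i j w a b) z := by
  have h1 : ContDiffAt ℂ ω (fderiv ℂ (M.trans i j)) z :=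
    (M.contDiffAt_trans i j h).fderiv_right (by simp)
  exact contDiffAt_pi.1 (h1.clm_apply (contDiffAt_const (c := Pi.single b 1))) a

end MonomialAtlas

namespace Union

variable {K : Type} {M : K → MonomialAtlas}

lemma transition_eventuallyEq (k : K) (i j : (M k).ι) {z : C2} (hz : (M k).hom i z j ≠ 0) :
    (fun w => chart ⟨k, j⟩ ((chart (⟨k, i⟩ : Index M)).symm w)) =ᶠ[𝓝 z] (M k).trans i j := by
  filter_upwards [((M k).isOpen_hom_ne_zero i j).mem_nhds hz] with w hw
  exact chart_symm k i j hw

lemma jacobian_eq (k : K) (i j : (M k).ι) {z : C2} (hz : (M k).hom i z j ≠ 0) :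
    jacobian (chart ⟨k, i⟩) (chart (⟨k, j⟩ : Index M)) z = (M k).jac i j z := by
  ext a b
  rw [jacobian, (transition_eventuallyEq k i j hz).fderiv_eq]
  rfl

/-- The connection on a disjoint union given by Christoffel symbols on the components. -/
def connection (G : ∀ k, (M k).Christoffel) : TangentConnection (Union M) where
  -- The value zero outside the atlas is never used.
  θ := Function.extend chart (fun c a b z => oneForm fun d => (G c.1).Γ a b d z) 0
  smooth := by
    rintro _ ⟨c, rfl⟩ a b
    rw [chart_injective.extend_apply]
    exact (contDiff_oneForm fun d => (G c.1).smooth a b d).contDiffOn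
  transform := by
    rintro _ ⟨c, rfl⟩ _ ⟨c', rfl⟩ z - hz a b v
    rw [chart_injective.extend_apply, chart_injective.extend_apply]
    obtain ⟨k, i, j, rfl, rfl, h⟩ := exists_of_symm_mem_source hz
    have hJ : (fun w => jacobian (chart ⟨k, i⟩) (chart (⟨k, j⟩ : Index M)) w a b) =ᶠ[𝓝 z]
        fun w => (M k).jac i j w a b := by
      filter_upwards [((M k).isOpen_hom_ne_zero i j).mem_nhds h] with w hw
      rw [jacobian_eq k i j hw]
    have hT := (M k).contDiffAt_trans i j h
    have h1 : ∀ l, fderiv ℝ ((M k).trans i j) z v l = ∑ d, v d * (M k).jac i j z l d := by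
      intro l
      rw [(hT.differentiableAt (by simp)).fderiv_restrictScalars ℝ,
        ContinuousLinearMap.coe_restrictScalars', clm_apply_eq_sum]
      simp [MonomialAtlas.jac, Finset.sum_apply]
    have h2 : fderiv ℝ (fun w => (M k).jac i j w a b) z v =
        ∑ d, v d * fderiv ℂ (fun w => (M k).jac i j w a b) z (Pi.single d 1) := by
      rw [(((M k).contDiffAt_jac i j h a b).differentiableAt
        (by simp)).fderiv_restrictScalars ℝ,
        ContinuousLinearMap.coe_restrictScalars', clm_apply_eq_sum]
      rfl
    rw [hJ.fderiv_eq, (transition_eventuallyEq k i j h).fderiv_eq, h2, chart_symm k i j h,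
      jacobian_eq k i j h]
    -- Both sides are complex linear in `v`, because the changes of charts are holomorphic; so the
    -- two coordinate directions suffice.
    have h3 := (G k).transform i j z h a b
    have h30 := h3 0
    have h31 := h3 1
    simp only [oneForm_apply, Fin.sum_univ_two, Matrix.cons_val_zero, h1] at h30 h31 ⊢
    linear_combination v 0 * h30 + v 1 * h31

lemma connection_curvature (G : ∀ k, (M k).Christoffel) (c : Index M) (z : C2) (a b : Fin 2)
    (u v : C2) : (connection G).curvature (chart c) z a b u v = (G c.1).curvature z a b u v := by
  have h : (connection G).θ (chart c) = fun a b z => oneForm fun d => (G c.1).Γ a b d z :=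
    chart_injective.extend_apply
      (fun c a b z => oneForm fun d => (G c.1).Γ a b d z) 0 c
  rw [TangentConnection.curvature, h, MonomialAtlas.Christoffel.curvature]
  beta_reduce
  rw [extDeriv_oneForm fun d => (G c.1).smooth a b d]
  simp

/-- The position of a chart in an enumeration of the charts of its component. -/
def rank (c : Index M) : ℕ := Fintype.equivFin (M c.1).ι c.2

/-- The pieces of a decomposition of the surface subordinate to the affine charts. -/
def piece (c : Index M) : Set (Union M) :=
  {x | x ∈ (chart c).source ∧ ∀ j : (M c.1).ι, rank (M := M) ⟨c.1, j⟩ < rank c →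
    x ∉ (chart (⟨c.1, j⟩ : Index M)).source}

lemma image_piece (c : Index M) : chart c '' piece c =
    {z | ∀ j : (M c.1).ι, rank (M := M) ⟨c.1, j⟩ < rank c → (M c.1).hom c.2 z j = 0} := by
  obtain ⟨k, i⟩ := c
  ext z
  constructor
  · rintro ⟨x, ⟨hx, hx'⟩, rfl⟩ j hj
    by_contra h
    refine hx' j hj ?_
    rw [← (chart ⟨k, i⟩).left_inv hx]
    exact (symm_mem_source k i j _).2 h
  · intro hz
    refine ⟨(chart ⟨k, i⟩).symm z, ⟨(chart ⟨k, i⟩).map_target (Set.mem_univ _), fun j hj h => ?_⟩,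
      (chart ⟨k, i⟩).right_inv (Set.mem_univ _)⟩
    exact (symm_mem_source k i j z).1 h (hz j hj)

lemma rank_injective (k : K) : Function.Injective fun i : (M k).ι => rank (M := M) ⟨k, i⟩ :=
  Fin.val_injective.comp (Fintype.equivFin (M k).ι).injective

lemma disjoint_piece {c c' : Index M} (h : c ≠ c') : Disjoint (piece c) (piece c') := by
  refine Set.disjoint_left.2 ?_
  rintro ⟨k, x⟩ ⟨hx, hx1⟩ ⟨hx', hx1'⟩
  obtain ⟨k₁, i⟩ := c
  obtain ⟨k₂, j⟩ := c'
  obtain rfl : k = k₁ := fst_eq_of_mem (x := x) hx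
  obtain rfl : k = k₂ := fst_eq_of_mem (x := x) hx'
  have hij : i ≠ j := fun hij => h (by rw [hij])
  rcases lt_or_gt_of_ne ((rank_injective k).ne hij) with hlt | hlt
  · exact hx1' i hlt hx
  · exact hx1 j hlt hx'

lemma exists_mem_piece (x : Union M) : ∃ c, x ∈ piece c := by
  classical
  obtain ⟨k, x⟩ := x
  obtain ⟨i, z, rfl⟩ := (M k).exists_pt x
  have hne : (Finset.univ.filter fun j => mk k ((M k).pt i z) ∈
      (chart (⟨k, j⟩ : Index M)).source).Nonempty :=
    ⟨i, by simp [mk_mem_chart_source]⟩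
  obtain ⟨j, hj, hmin⟩ := Finset.exists_min_image _ (fun j => rank (M := M) ⟨k, j⟩) hne
  refine ⟨⟨k, j⟩, (Finset.mem_filter.1 hj).2, fun l hl hl' => ?_⟩
  exact absurd (hmin l (Finset.mem_filter.2 ⟨Finset.mem_univ _, hl'⟩)) (not_le.2 hl)

lemma measurableSet_image_piece (c : Index M) : MeasurableSet (chart c '' piece c) := by
  rw [image_piece]
  have h : {z | ∀ j : (M c.1).ι, rank (M := M) ⟨c.1, j⟩ < rank c → (M c.1).hom c.2 z j = 0} =
      ⋂ (j : (M c.1).ι) (_ : rank (M := M) ⟨c.1, j⟩ < rank c), {z | (M c.1).hom c.2 z j = 0} := by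
    ext z
    simp
  rw [h]
  exact (isClosed_iInter fun j => isClosed_iInter fun _ =>
    isClosed_singleton.preimage ((M c.1).continuous_hom c.2 j)).measurableSet

lemma exists_rank_eq_zero (k : K) : ∃ i : (M k).ι, rank (M := M) ⟨k, i⟩ = 0 :=
  ⟨(Fintype.equivFin (M k).ι).symm ⟨0, Fintype.card_pos⟩, by simp [rank]⟩

lemma image_piece_of_rank_eq_zero {c : Index M} (h : rank c = 0) :
    chart c '' piece c = Set.univ := by
  rw [image_piece]
  simp [h]

/-- Such a piece avoids the chart of rank zero. There a monomial in the coordinates vanishes, so the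
piece lies in the union of the two axes. -/
lemma volume_image_piece_of_rank_ne_zero {c : Index M} (h : rank c ≠ 0) :
    volume (chart c '' piece c) = 0 := by
  obtain ⟨i, hi⟩ := exists_rank_eq_zero (M := M) c.1
  refine measure_mono_null (t := {z : C2 | z 0 = 0} ∪ {z | z 1 = 0}) ?_
    (measure_union_null (volume_coord_eq_zero 0) (volume_coord_eq_zero 1))
  rw [image_piece]
  intro z hz
  by_contra hz'
  simp only [Set.mem_union, Set.mem_ofPred_eq, not_or] at hz'
  refine (M c.1).hom_ne_zero_of_torus c.2 i (fun l => ?_) (hz i (by omega))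
  fin_cases l
  exacts [hz'.1, hz'.2]

/-- On each component only the piece of rank zero, which is all of `ℂ²`, has nonzero measure; hence
the integral of `C k * w k` over the component `k` is `C k`. -/
lemma hasIntegral [Fintype K] {w : K → C2 → ℝ} (hw : ∀ k, Integrable (w k))
    (hw1 : ∀ k, ∫ z, w k z = 1) {C : K → ℂ} {ρ : OpenPartialHomeomorph (Union M) C2 → C2 → ℂ}
    (hρ : ∀ (c : Index M) z, ρ (chart c) z = C c.1 * w c.1 z) :
    HasIntegral (Union M) ρ (∑ k, C k) := by
  let σ := (Fintype.equivFin (Index M)).symm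
  have hint : ∀ c : Index M, Integrable (ρ (chart c)) := fun c => by
    rw [show ρ (chart c) = fun z => C c.1 * w c.1 z from funext (hρ c)]
    exact (hw c.1).ofReal.const_mul _
  refine ⟨_, fun n => chart (σ n), fun n => piece (σ n), fun n => chart_mem_atlas _,
    fun n x hx => hx.1, fun n => measurableSet_image_piece _,
    fun n n' h => disjoint_piece (σ.injective.ne h), ?_, fun n => (hint _).integrableOn, ?_⟩
  · refine Set.eq_univ_of_forall fun x => ?_
    obtain ⟨c, hc⟩ := exists_mem_piece x
    exact Set.mem_iUnion.2 ⟨σ.symm c, by simpa using hc⟩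
  · rw [σ.sum_comp fun c => ∫ z in chart c '' piece c, ρ (chart c) z, Fintype.sum_sigma]
    refine Finset.sum_congr rfl fun k _ => ?_
    obtain ⟨i, hi⟩ := exists_rank_eq_zero (M := M) k
    rw [Finset.sum_eq_single i]
    · rw [image_piece_of_rank_eq_zero hi, setIntegral_univ]
      simp only [hρ]
      rw [integral_const_mul, integral_complex_ofReal, hw1]
      simp
    · intro j _ hj
      refine setIntegral_measure_zero _ (volume_image_piece_of_rank_ne_zero fun h => hj ?_)
      exact rank_injective k (h.trans hi.symm)
    · simp

end Union
end ToricSurf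

namespace ToricSurf

open Topology MeasureTheory ComplexConjugate

/-! ### Two integrals -/

section Integrals

variable {a : ℝ} (ha : 0 < a) (n : ℕ)

include ha

/-- Polar coordinates in `ℂ` turn `(a + ‖z‖²)^(-(n + 2))` into this radial integrand. Its primitive
tends to zero at infinity, which gives both integrability and the value of the integral. -/
lemma hasDerivAt_neg_inv_add_sq_pow (x : ℝ) :
    HasDerivAt (fun x => -(2 * (n + 1) * (a + x ^ 2) ^ (n + 1))⁻¹)
      (x * ((a + x ^ 2) ^ (n + 2))⁻¹) x := by
  have h0 : a + x ^ 2 ≠ 0 := by positivity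
  have hn : (n : ℝ) + 1 ≠ 0 := by positivity
  have h1 : HasDerivAt (fun x => 2 * (n + 1) * (a + x ^ 2) ^ (n + 1))
      (2 * (n + 1) * (((n + 1 : ℕ) : ℝ) * (a + x ^ 2) ^ n * (2 * x))) x := by
    have h2 := (((hasDerivAt_pow 2 x).const_add a).fun_pow (n + 1)).const_mul (2 * ((n : ℝ) + 1))
    exact h2.congr_deriv (by simp)
  have h3 := (h1.fun_inv (by positivity)).neg
  refine h3.congr_deriv ?_
  push_cast
  field_simp
  ring

omit ha in
lemma tendsto_neg_inv_add_sq_pow :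
    Filter.Tendsto (fun x : ℝ => -(2 * (n + 1) * (a + x ^ 2) ^ (n + 1))⁻¹) Filter.atTop (𝓝 0) := by
  rw [← neg_zero]
  refine Filter.Tendsto.neg (Filter.Tendsto.inv_tendsto_atTop ?_)
  refine Filter.Tendsto.const_mul_atTop (by positivity) ?_
  exact (Filter.tendsto_pow_atTop (by simp)).comp
    (Filter.tendsto_atTop_add_const_left _ _ (Filter.tendsto_pow_atTop (by simp)))

lemma integrable_inv_add_norm_sq_pow :
    Integrable fun z : ℂ => ((a + ‖z‖ ^ 2) ^ (n + 2))⁻¹ := by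
  refine (integrable_fun_norm_addHaar volume (f := fun x => ((a + x ^ 2) ^ (n + 2))⁻¹)).2 ?_
  rw [Complex.finrank_real_complex]
  simp only [Nat.reduceSub, pow_one, smul_eq_mul]
  refine integrableOn_Ioi_deriv_of_nonneg' (fun x _ => hasDerivAt_neg_inv_add_sq_pow ha n x)
    (fun x hx => ?_) (tendsto_neg_inv_add_sq_pow n)
  have : 0 < x := hx
  positivity

lemma integral_inv_add_norm_sq_pow :
    ∫ z : ℂ, ((a + ‖z‖ ^ 2) ^ (n + 2))⁻¹ = Real.pi / (n + 1) * (a ^ (n + 1))⁻¹ := by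
  rw [integral_fun_norm_addHaar volume fun x => ((a + x ^ 2) ^ (n + 2))⁻¹,
    Complex.finrank_real_complex]
  simp only [Nat.reduceSub, pow_one, smul_eq_mul]
  rw [integral_Ioi_of_hasDerivAt_of_nonneg' (fun x _ => hasDerivAt_neg_inv_add_sq_pow ha n x)
    (fun x hx => ?_) (tendsto_neg_inv_add_sq_pow n), Measure.real, Complex.volume_ball]
  · simp
    field_simp
  · have : 0 < x := hx
    positivity

end Integrals

lemma integrable_and_integral_finTwo {f : ℂ × ℂ → ℝ} (hf : Integrable f) :
    Integrable (fun z : C2 => f (z 0, z 1)) ∧ ∫ z : C2, f (z 0, z 1) = ∫ p, f p := by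
  have h := volume_preserving_finTwoArrow ℂ
  exact ⟨(h.integrable_comp_emb (MeasurableEquiv.measurableEmbedding _)).2 hf,
    h.integral_comp (MeasurableEquiv.measurableEmbedding _) f⟩

/-- Integrating over the second variable, with `a = 1 + ‖x‖²` and `n = 1`, leaves a multiple of `(1
+ ‖x‖²)⁻²`, the case `a = 1`, `n = 0` of the same formula. -/
lemma integrable_fubiniStudy :
    Integrable (fun p : ℂ × ℂ => ((1 + ‖p.1‖ ^ 2 + ‖p.2‖ ^ 2) ^ 3)⁻¹) := by
  have hc : Continuous (fun p : ℂ × ℂ => ((1 + ‖p.1‖ ^ 2 + ‖p.2‖ ^ 2) ^ 3)⁻¹) :=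
    Continuous.inv₀ (by fun_prop) fun p => by positivity
  refine (integrable_prod_iff hc.aestronglyMeasurable).2 ⟨?_, ?_⟩
  · exact Filter.Eventually.of_forall fun x =>
      integrable_inv_add_norm_sq_pow (a := 1 + ‖x‖ ^ 2) (by positivity) 1
  · have h : ∀ x : ℂ, ∫ y : ℂ, ‖((1 + ‖x‖ ^ 2 + ‖y‖ ^ 2) ^ 3)⁻¹‖ =
        Real.pi / 2 * ((1 + ‖x‖ ^ 2) ^ 2)⁻¹ := by
      intro x
      have h1 := integral_inv_add_norm_sq_pow (a := 1 + ‖x‖ ^ 2) (by positivity) 1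
      norm_num at h1
      rw [← h1]
      exact integral_congr_ae (Filter.Eventually.of_forall fun y =>
        Real.norm_of_nonneg (by positivity))
    simp only [h]
    exact (integrable_inv_add_norm_sq_pow one_pos 0).const_mul _

lemma integral_fubiniStudy :
    ∫ p : ℂ × ℂ, ((1 + ‖p.1‖ ^ 2 + ‖p.2‖ ^ 2) ^ 3)⁻¹ = Real.pi ^ 2 / 2 := by
  rw [Measure.volume_eq_prod, integral_prod _ integrable_fubiniStudy]
  have h : ∀ x : ℂ, ∫ y : ℂ, ((1 + ‖x‖ ^ 2 + ‖y‖ ^ 2) ^ 3)⁻¹ =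
      Real.pi / 2 * ((1 + ‖x‖ ^ 2) ^ 2)⁻¹ := by
    intro x
    have h1 := integral_inv_add_norm_sq_pow (a := 1 + ‖x‖ ^ 2) (by positivity) 1
    norm_num at h1 ⊢
    exact h1
  have h2 := integral_inv_add_norm_sq_pow one_pos 0
  norm_num at h2
  simp only [h]
  rw [integral_const_mul, h2]
  ring

lemma integrable_fubiniStudy_prod :
    Integrable (fun p : ℂ × ℂ => ((1 + ‖p.1‖ ^ 2) ^ 2)⁻¹ * ((1 + ‖p.2‖ ^ 2) ^ 2)⁻¹) :=
  (integrable_inv_add_norm_sq_pow one_pos 0).mul_prod (integrable_inv_add_norm_sq_pow one_pos 0)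

lemma integral_fubiniStudy_prod :
    ∫ p : ℂ × ℂ, ((1 + ‖p.1‖ ^ 2) ^ 2)⁻¹ * ((1 + ‖p.2‖ ^ 2) ^ 2)⁻¹ = Real.pi ^ 2 := by
  have h2 := integral_inv_add_norm_sq_pow one_pos 0
  norm_num at h2
  rw [Measure.volume_eq_prod, integral_prod_mul (fun x : ℂ => ((1 + ‖x‖ ^ 2) ^ 2)⁻¹)
    fun x : ℂ => ((1 + ‖x‖ ^ 2) ^ 2)⁻¹, h2, sq]

/-! ### Chern numbers of a connection given by Christoffel symbols -/

/-- The form `∑ A c k dz̄_k ∧ dz_c` of type `(1, 1)`. -/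
def hermForm (A : Matrix (Fin 2) (Fin 2) ℂ) (u v : C2) : ℂ :=
  ∑ c, ∑ k, A c k * (conj (u k) * v c - conj (v k) * u c)

/-- Since `dz̄ ∧ dz = 2i dx ∧ dy`, the constant is `(2i)² = -4`; the rest is the polarised
determinant. -/
lemma wedgeCoeff_hermForm (A B : Matrix (Fin 2) (Fin 2) ℂ) :
    wedgeCoeff (hermForm A) (hermForm B) =
      -4 * (A 0 0 * B 1 1 + A 1 1 * B 0 0 - A 0 1 * B 1 0 - A 1 0 * B 0 1) := by
  simp only [wedgeCoeff, hermForm, realBasis, Fin.sum_univ_two, Matrix.cons_val, map_one, map_zero,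
    Complex.conj_I]
  ring_nf
  simp only [Complex.I_sq]
  ring

lemma wedgeCoeff_smul (r s : ℂ) (a b : C2 → C2 → ℂ) :
    wedgeCoeff (fun u v => r * a u v) (fun u v => s * b u v) = r * s * wedgeCoeff a b := by
  simp only [wedgeCoeff]
  ring

lemma hermForm_add (A B : Matrix (Fin 2) (Fin 2) ℂ) (u v : C2) :
    hermForm (A + B) u v = hermForm A u v + hermForm B u v := by
  simp [hermForm]
  ring

/-- A connection whose Chern forms are multiples of a density of total mass one. -/
structure ChernData (M : MonomialAtlas) where
  G : M.Christoffel
  curv : Fin 2 → Fin 2 → C2 → Matrix (Fin 2) (Fin 2) ℂ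
  curvature_eq : ∀ z a b u v, G.curvature z a b u v = hermForm (curv a b z) u v
  c₁sq : ℚ
  c₂ : ℚ
  density : C2 → ℝ
  integrable : Integrable density
  integral_eq_one : ∫ z, density z = 1
  chern₁ : ∀ z, (Complex.I / (2 * Real.pi)) ^ 2 *
    wedgeCoeff (hermForm (curv 0 0 z + curv 1 1 z)) (hermForm (curv 0 0 z + curv 1 1 z)) =
      c₁sq * density z
  chern₂ : ∀ z, (Complex.I / (2 * Real.pi)) ^ 2 *
    (wedgeCoeff (hermForm (curv 0 0 z)) (hermForm (curv 1 1 z)) -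
      wedgeCoeff (hermForm (curv 0 1 z)) (hermForm (curv 1 0 z))) = c₂ * density z

end ToricSurf

namespace ToricSurf

open Topology MeasureTheory ComplexConjugate

lemma HasFDerivAt.complex_div {𝕜 E : Type*} [NontriviallyNormedField 𝕜] [NormedAlgebra 𝕜 ℂ]
    [NormedAddCommGroup E] [NormedSpace 𝕜 E] {f g : E → ℂ} {f' g' : E →L[𝕜] ℂ} {z : E}
    (hf : HasFDerivAt f f' z) (hg : HasFDerivAt g g' z) (h : g z ≠ 0) :
    HasFDerivAt (fun w => f w / g w) ((g z ^ 2)⁻¹ • (g z • f' - f z • g')) z := by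
  have h1 := hf.mul ((hasDerivAt_inv h).comp_hasFDerivAt z hg)
  refine (h1.congr_fderiv ?_).congr_of_eventuallyEq
    (Filter.Eventually.of_forall fun w => div_eq_mul_inv _ _)
  ext v
  simp
  field_simp
  ring

lemma ContDiff.complex_div {f g : C2 → ℂ} (hf : ContDiff ℝ ∞ f) (hg : ContDiff ℝ ∞ g)
    (h : ∀ z, g z ≠ 0) : ContDiff ℝ ∞ fun z => f z / g z := by
  simp only [div_eq_mul_inv]
  exact hf.mul (hg.inv h)

/-! ### The projective plane -/

/-- The affine charts of the projective plane. -/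
def planeAtlas : MonomialAtlas where
  ι := Fin 3
  -- In the chart `i` the coordinate `i` is one, and `succAbove` enumerates the other two.
  exponent i k l := if k = i.succAbove l then 1 else 0
  neighbour i a := i.succAbove a
  exponent_self := by decide
  exponent_ne_zero := by decide
  exponent_neighbour := by decide
  exponent_glue := by decide

/-- The function `1 + |z|²`. -/
def planeRho (z : C2) : ℂ := 1 + (z 0 * conj (z 0) + z 1 * conj (z 1))

lemma planeRho_eq (z : C2) : planeRho z = ((1 + ‖z 0‖ ^ 2 + ‖z 1‖ ^ 2 : ℝ) : ℂ) := by
  simp [planeRho, Complex.mul_conj']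
  ring

lemma planeRho_ne_zero (z : C2) : planeRho z ≠ 0 := by
  rw [planeRho_eq, Complex.ofReal_ne_zero]
  positivity

lemma contDiff_coord (a : Fin 2) : ContDiff ℝ ∞ fun z : C2 => z a :=
  contDiff_apply ℝ ℂ a

lemma contDiff_conj_coord (a : Fin 2) : ContDiff ℝ ∞ fun z : C2 => conj (z a) :=
  Complex.conjCLE.contDiff.comp (contDiff_coord a)

lemma contDiff_planeRho : ContDiff ℝ ∞ planeRho :=
  contDiff_const.add (((contDiff_coord 0).mul (contDiff_conj_coord 0)).add
    ((contDiff_coord 1).mul (contDiff_conj_coord 1)))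

/-- The components of `∂ log (1 + |z|²)`. -/
def planeP (c : Fin 2) (z : C2) : ℂ := conj (z c) / planeRho z

lemma contDiff_planeP (c : Fin 2) : ContDiff ℝ ∞ (planeP c) :=
  ContDiff.complex_div (contDiff_conj_coord c) contDiff_planeRho planeRho_ne_zero

namespace planeAtlas

lemma sum_eq (j : planeAtlas.ι) (f : planeAtlas.ι → ℂ) :
    ∑ k, f k = f j + ∑ l, f (planeAtlas.neighbour j l) :=
  Fin.sum_univ_succAbove f j

/-- On a chart each homogeneous coordinate is one or an affine coordinate, so its derivative is a
constant linear form. This permits computing with all pairs of charts at once. -/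
lemma hasFDerivAt_hom (i : planeAtlas.ι) : ∃ L : planeAtlas.ι → C2 →L[ℂ] ℂ,
    (∀ k z, HasFDerivAt (fun w => planeAtlas.hom i w k) (L k) z) ∧ L i = 0 ∧
      ∀ a, L (planeAtlas.neighbour i a) = ContinuousLinearMap.proj a := by
  have h : ∀ k : planeAtlas.ι, ∃ L : C2 →L[ℂ] ℂ,
      (∀ z, HasFDerivAt (fun w => planeAtlas.hom i w k) L z) ∧ (k = i → L = 0) ∧
      ∀ a, k = planeAtlas.neighbour i a → L = ContinuousLinearMap.proj a := by
    intro k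
    have hne : ∀ a : Fin 2, planeAtlas.neighbour i a ≠ i := fun a => Fin.succAbove_ne i a
    by_cases hk : k = i
    · refine ⟨0, fun z => ?_, fun _ => rfl, fun a ha => absurd (ha.symm.trans hk) (hne a)⟩
      rw [hk]
      exact (hasFDerivAt_const (1 : ℂ) z).congr_of_eventuallyEq
        (Filter.Eventually.of_forall fun w => planeAtlas.hom_self i w)
    · obtain ⟨a, ha⟩ : ∃ a, planeAtlas.neighbour i a = k := Fin.exists_succAbove_eq hk
      refine ⟨ContinuousLinearMap.proj a, fun z => ?_, fun h => absurd h hk, fun b hb => ?_⟩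
      · rw [← ha]
        exact (ContinuousLinearMap.proj (R := ℂ) (φ := fun _ : Fin 2 => ℂ) a).hasFDerivAt
          |>.congr_of_eventuallyEq
            (Filter.Eventually.of_forall fun w => planeAtlas.hom_neighbour i w a)
      · rw [Fin.succAbove_right_injective (ha.trans hb)]
  choose L hL using h
  exact ⟨L, fun k => (hL k).1, (hL i).2.1 rfl, fun a => (hL _).2.2 a rfl⟩

/-- In every chart `i`, `planeRho` is `|X|² / |X i|²`; between charts it changes by the squared
modulus of a holomorphic function. -/
lemma sum_hom_mul_conj (i : planeAtlas.ι) (z : C2) :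
    ∑ k, planeAtlas.hom i z k * conj (planeAtlas.hom i z k) = planeRho z := by
  rw [sum_eq i]
  simp [planeRho]

/-- The algebra behind the transformation law of the symbols `-(δ_ab p_c + δ_ac p_b)`: it reduces to
`p' J = p - d`, used for the indices `c` and `b`. -/
lemma christoffel_identity {J : Matrix (Fin 2) (Fin 2) ℂ} {p p' d : Fin 2 → ℂ}
    (h : ∀ c, ∑ l, p' l * J l c = p c - d c) (a b c : Fin 2) :
    ∑ k, J a k * -((if k = b then p c else 0) + if k = c then p b else 0) =
      -(J a b * d c + J a c * d b) +
        ∑ k, ∑ l, -((if a = k then p' l else 0) + if a = l then p' k else 0) * J l c * J k b := by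
  have E := congrArg₂ (· + ·) (congrArg (J a b * ·) (h c)) (congrArg (J a c * ·) (h b))
  simp only [Fin.sum_univ_two] at E ⊢
  fin_cases a <;> fin_cases b <;> fin_cases c <;> simp at E ⊢ <;> linear_combination E

/-- Let `d = d log X j`. The change of charts has components `X (neighbour j a) / X j`, quotients of
affine linear functions, so `∂_c J_ab = -(J_ab d_c + J_ac d_b)`. As `log planeRho` changes by `-log
|X j|²`, its derivative `p` satisfies `p' J = p - d`, and `christoffel_identity` applies. -/
lemma transform (i j : planeAtlas.ι) (z : C2) (hz : planeAtlas.hom i z j ≠ 0) (a b c : Fin 2) :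
    ∑ k, planeAtlas.jac i j z a k *
        -((if k = b then planeP c z else 0) + if k = c then planeP b z else 0) =
      fderiv ℂ (fun w => planeAtlas.jac i j w a b) z (Pi.single c 1) +
        ∑ k, ∑ l, -((if a = k then planeP l (planeAtlas.trans i j z) else 0) +
          if a = l then planeP k (planeAtlas.trans i j z) else 0) *
            planeAtlas.jac i j z l c * planeAtlas.jac i j z k b := by
  obtain ⟨L, hL, hLi, hLa⟩ := hasFDerivAt_hom i
  set g : planeAtlas.ι → C2 → ℂ := fun k w => planeAtlas.hom i w k with hg
  let D : planeAtlas.ι → Fin 2 → ℂ := fun k b => L k (Pi.single b 1)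
  have hT : ∀ a w, g j w ≠ 0 → HasFDerivAt (fun w => planeAtlas.trans i j w a)
      ((g j w ^ 2)⁻¹ • (g j w • L (planeAtlas.neighbour j a) -
        g (planeAtlas.neighbour j a) w • L j)) w := fun a w hw =>
    HasFDerivAt.complex_div (hL (planeAtlas.neighbour j a) w) (hL j w) hw
  have hJ : ∀ w, g j w ≠ 0 → ∀ a b, planeAtlas.jac i j w a b =
      (D (planeAtlas.neighbour j a) b * g j w - g (planeAtlas.neighbour j a) w * D j b) /
        g j w ^ 2 := by
    intro w hw a b
    have h := (hasFDerivAt_pi.2 fun a => hT a w hw).fderiv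
    have h' : fderiv ℂ (planeAtlas.trans i j) w = _ := h
    rw [show planeAtlas.jac i j w a b = fderiv ℂ (planeAtlas.trans i j) w (Pi.single b 1) a from rfl,
      h']
    simp [D]
    field_simp
  have hdJ : fderiv ℂ (fun w => planeAtlas.jac i j w a b) z (Pi.single c 1) =
      -(planeAtlas.jac i j z a b * D j c + planeAtlas.jac i j z a c * D j b) / g j z := by
    have hev : (fun w => planeAtlas.jac i j w a b) =ᶠ[𝓝 z] fun w =>
        (D (planeAtlas.neighbour j a) b * g j w - g (planeAtlas.neighbour j a) w * D j b) /
          g j w ^ 2 := by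
      filter_upwards [(planeAtlas.isOpen_hom_ne_zero i j).mem_nhds hz] with w hw
      exact hJ w hw a b
    have h1 := (HasFDerivAt.complex_div (((hL j z).const_mul (D (planeAtlas.neighbour j a) b)).sub
      ((hL (planeAtlas.neighbour j a) z).mul_const (D j b))) ((hL j z).pow 2)
        (pow_ne_zero 2 hz)).fderiv
    rw [hev.fderiv_eq, hJ z hz, hJ z hz]
    refine (congrArg (fun l : C2 →L[ℂ] ℂ => l (Pi.single c 1)) h1).trans ?_
    simp [D]
    simp only [hg] at hz ⊢
    field_simp
    ring
  have hconj : conj (g j z) ≠ 0 := by simpa using hz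
  have hrho : planeRho (planeAtlas.trans i j z) = planeRho z / (g j z * conj (g j z)) := by
    rw [← sum_hom_mul_conj j, ← sum_hom_mul_conj i, Finset.sum_div]
    refine Finset.sum_congr rfl fun k _ => ?_
    rw [planeAtlas.hom_trans i j k hz, map_div₀, div_mul_div_comm]
  have hP : ∀ c, ∑ l, planeP l (planeAtlas.trans i j z) * planeAtlas.jac i j z l c =
      planeP c z - D j c / g j z := by
    intro c
    have h1 : ∑ k, conj (g k z) * D k c = conj (z c) := by
      rw [sum_eq i]
      simp only [D, hLi, hLa, g, MonomialAtlas.hom_neighbour]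
      simp [Pi.single_apply]
    have h2 := sum_hom_mul_conj i z
    rw [sum_eq j] at h1 h2
    have h3 := planeRho_ne_zero z
    change g j z ≠ 0 at hz
    simp only [planeP, hrho, hJ z hz]
    simp only [MonomialAtlas.trans, map_div₀, Fin.sum_univ_two, hg] at h1 h2 hz hconj ⊢
    field_simp
    linear_combination planeAtlas.hom i z j * h1 - D j c * h2
  rw [hdJ, neg_div, add_div, mul_div_assoc, mul_div_assoc]
  exact christoffel_identity hP a b c

/-- The Levi-Civita connection of the Fubini-Study metric. -/
def christoffel : planeAtlas.Christoffel where
  Γ a b c z := -((if a = b then planeP c z else 0) + if a = c then planeP b z else 0)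
  smooth a b c := by
    refine (ContDiff.add ?_ ?_).neg
    · split_ifs
      exacts [contDiff_planeP c, contDiff_const]
    · split_ifs
      exacts [contDiff_planeP b, contDiff_const]
  transform i j z hz a b c := transform i j z hz a b c

lemma hasFDerivAt_planeRho (z : C2) : ∃ L : C2 →L[ℝ] ℂ, HasFDerivAt planeRho L z ∧
    ∀ u, L u = ∑ k, (conj (z k) * u k + z k * conj (u k)) := by
  have h : ∀ k, HasFDerivAt (fun z : C2 => z k) (ContinuousLinearMap.proj k : C2 →L[ℝ] ℂ) z :=
    fun k => (ContinuousLinearMap.proj k : C2 →L[ℝ] ℂ).hasFDerivAt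
  have h' : ∀ k, HasFDerivAt (fun z : C2 => conj (z k))
      (Complex.conjCLE.toContinuousLinearMap.comp (ContinuousLinearMap.proj k : C2 →L[ℝ] ℂ)) z :=
    fun k => Complex.conjCLE.toContinuousLinearMap.hasFDerivAt.comp z (h k)
  refine ⟨_, (((h 0).mul (h' 0)).add ((h 1).mul (h' 1))).const_add 1, fun u => ?_⟩
  simp
  ring

lemma fderiv_planeP (c : Fin 2) (z u : C2) : fderiv ℝ (planeP c) z u =
    conj (u c) * (planeRho z)⁻¹ -
      conj (z c) * (∑ k, (conj (z k) * u k + z k * conj (u k))) * (planeRho z)⁻¹ ^ 2 := by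
  obtain ⟨L, hL, hLu⟩ := hasFDerivAt_planeRho z
  have h : HasFDerivAt (fun z : C2 => conj (z c))
      (Complex.conjCLE.toContinuousLinearMap.comp (ContinuousLinearMap.proj c : C2 →L[ℝ] ℂ)) z :=
    Complex.conjCLE.toContinuousLinearMap.hasFDerivAt.comp z
      (ContinuousLinearMap.proj c : C2 →L[ℝ] ℂ).hasFDerivAt
  have h1 := (HasFDerivAt.complex_div h hL (planeRho_ne_zero z)).fderiv
  have h2 := congrArg (fun l : C2 →L[ℝ] ℂ => l u) h1
  refine Eq.trans h2 ?_
  have h3 := planeRho_ne_zero z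
  simp [hLu]
  field_simp

/-- The matrix of the Fubini-Study form. -/
def metric (z : C2) : Matrix (Fin 2) (Fin 2) ℂ := Matrix.of fun c k =>
  (if c = k then (planeRho z)⁻¹ else 0) - conj (z c) * z k * (planeRho z)⁻¹ ^ 2

/-- The matrix is `ρ⁻¹` minus one of rank one, so the determinant is `ρ⁻² (1 - |z|² / ρ)`, and `ρ -
|z|² = 1`. -/
lemma det_metric (z : C2) : metric z 0 0 * metric z 1 1 - metric z 0 1 * metric z 1 0 =
    (planeRho z)⁻¹ ^ 3 := by
  have h := planeRho_ne_zero z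
  simp only [metric]
  simp
  field_simp
  simp only [planeRho]
  ring

lemma fderiv_christoffel (a b c : Fin 2) (z u : C2) : fderiv ℝ (christoffel.Γ a b c) z u =
    -((if a = b then fderiv ℝ (planeP c) z u else 0) +
      if a = c then fderiv ℝ (planeP b) z u else 0) := by
  have h : ∀ c, DifferentiableAt ℝ (planeP c) z := fun c =>
    (contDiff_planeP c).contDiffAt.differentiableAt (by simp)
  have h1 : ∀ (p : Prop) [Decidable p] (c : Fin 2),
      HasFDerivAt (fun z => if p then planeP c z else 0)
        (if p then fderiv ℝ (planeP c) z else 0) z := by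
    intro p _ c
    split_ifs
    exacts [(h c).hasFDerivAt, hasFDerivAt_const _ _]
  have h2 := ((h1 (a = b) c).add (h1 (a = c) b)).neg.fderiv
  refine (congrArg (fun l : C2 →L[ℝ] ℂ => l u) h2).trans ?_
  simp only [_root_.neg_apply, _root_.add_apply]
  split_ifs <;> rfl

/-- The Fubini-Study connection, with its Chern numbers. -/
def chernData : ChernData planeAtlas where
  G := christoffel
  -- This is `∂̄Γ`, with `metric` the matrix of `∂̄` of `planeP`; the `(2, 0)` part of `dθ` cancels
  -- against `θ ∧ θ`.
  curv a b z := Matrix.of fun c k =>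
    -(if a = b then metric z c k else 0) - if a = c then metric z b k else 0
  curvature_eq z a b u v := by
    simp only [MonomialAtlas.Christoffel.curvature, fderiv_christoffel, fderiv_planeP, hermForm]
    simp only [christoffel, planeP, metric, Matrix.of_apply, div_eq_mul_inv, Fin.sum_univ_two]
    generalize (planeRho z)⁻¹ = r
    fin_cases a <;> fin_cases b <;> simp <;> ring
  -- The trace of the curvature is `-3` times the form of `metric`, and `density` below is the
  -- square of `i / 2π` times that form.
  c₁sq := 9
  c₂ := 3
  density z := 2 / Real.pi ^ 2 * ((1 + ‖z 0‖ ^ 2 + ‖z 1‖ ^ 2) ^ 3)⁻¹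
  integrable := (integrable_and_integral_finTwo integrable_fubiniStudy).1.const_mul _
  integral_eq_one := by
    have h := (integrable_and_integral_finTwo integrable_fubiniStudy).2
    simp only at h
    rw [integral_const_mul, h, integral_fubiniStudy]
    field_simp
  chern₁ z := by
    have h := det_metric z
    have hpi : (Real.pi : ℂ) ≠ 0 := by simp [Real.pi_ne_zero]
    have hr := planeRho_eq z
    rw [wedgeCoeff_hermForm]
    push_cast at hr ⊢
    rw [← hr, ← inv_pow, ← h]
    simp [div_pow]
    field_simp
    ring
  chern₂ z := by
    have h := det_metric z
    have hpi : (Real.pi : ℂ) ≠ 0 := by simp [Real.pi_ne_zero]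
    have hr := planeRho_eq z
    rw [wedgeCoeff_hermForm, wedgeCoeff_hermForm]
    push_cast at hr ⊢
    rw [← hr, ← inv_pow, ← h]
    simp [div_pow]
    field_simp
    ring

end planeAtlas
end ToricSurf

namespace ToricSurf

open Topology MeasureTheory ComplexConjugate

/-! ### The product of two projective lines -/

/-- The affine charts of the product of two projective lines. -/
def quadricAtlas : MonomialAtlas where
  ι := Fin 2 → Bool
  -- Charts and Segre coordinates are indexed by the vertices of a square; the coordinate `k` is the
  -- product of the `z l` over the directions in which `k` and `i` differ.
  exponent i k l := (k l ^^ i l).toNat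
  neighbour i a := Function.update i a (!i a)
  exponent_self := by simp
  exponent_ne_zero i j h h' := by
    refine h (funext fun l => ?_)
    have := congrFun h' l
    revert this
    cases i l <;> cases j l <;> simp
  exponent_neighbour i a l := by
    rcases eq_or_ne l a with rfl | h <;> simp [*]
  exponent_glue i j k l := by
    simp only [Fin.sum_univ_two]
    fin_cases l <;> simp <;> cases i 0 <;> cases i 1 <;> cases j 0 <;> cases j 1 <;>
      cases k 0 <;> cases k 1 <;> rfl

/-- The function `1 + |z|²` of one of the coordinates. -/
def lineRho (a : Fin 2) (z : C2) : ℂ := 1 + z a * conj (z a)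

lemma lineRho_eq (a : Fin 2) (z : C2) : lineRho a z = ((1 + ‖z a‖ ^ 2 : ℝ) : ℂ) := by
  simp [lineRho, Complex.mul_conj']

lemma lineRho_ne_zero (a : Fin 2) (z : C2) : lineRho a z ≠ 0 := by
  rw [lineRho_eq, Complex.ofReal_ne_zero]
  positivity

/-- The component of `∂ log (1 + |z|²)`, for one of the coordinates. -/
def lineP (a : Fin 2) (z : C2) : ℂ := conj (z a) / lineRho a z

lemma contDiff_lineP (a : Fin 2) : ContDiff ℝ ∞ (lineP a) :=
  ContDiff.complex_div (contDiff_conj_coord a)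
    (contDiff_const.add ((contDiff_coord a).mul (contDiff_conj_coord a))) (lineRho_ne_zero a)

lemma fderiv_lineP (a : Fin 2) (z u : C2) : fderiv ℝ (lineP a) z u =
    conj (u a) * (lineRho a z)⁻¹ -
      conj (z a) * (conj (z a) * u a + z a * conj (u a)) * (lineRho a z)⁻¹ ^ 2 := by
  have h : HasFDerivAt (fun z : C2 => z a) (ContinuousLinearMap.proj a : C2 →L[ℝ] ℂ) z :=
    (ContinuousLinearMap.proj a : C2 →L[ℝ] ℂ).hasFDerivAt
  have h' : HasFDerivAt (fun z : C2 => conj (z a))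
      (Complex.conjCLE.toContinuousLinearMap.comp (ContinuousLinearMap.proj a : C2 →L[ℝ] ℂ)) z :=
    Complex.conjCLE.toContinuousLinearMap.hasFDerivAt.comp z h
  have hρ : HasFDerivAt (lineRho a) _ z := (h.mul h').const_add 1
  have h1 := (HasFDerivAt.complex_div h' hρ (lineRho_ne_zero a z)).fderiv
  refine (congrArg (fun l : C2 →L[ℝ] ℂ => l u) h1).trans ?_
  have h3 := lineRho_ne_zero a z
  simp
  field_simp
  ring

namespace quadricAtlas

lemma hom_eq (i k : Fin 2 → Bool) (z : C2) :
    quadricAtlas.hom i z k = (if k 0 = i 0 then 1 else z 0) * if k 1 = i 1 then 1 else z 1 := by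
  have h : quadricAtlas.hom i z k = ∏ l, z l ^ (k l ^^ i l).toNat := rfl
  rw [h, Fin.prod_univ_two]
  cases i 0 <;> cases i 1 <;> cases k 0 <;> cases k 1 <;> simp

lemma ne_zero_of_hom {i j : Fin 2 → Bool} {z : C2} (hz : quadricAtlas.hom i z j ≠ 0) {a : Fin 2}
    (h : j a ≠ i a) : z a ≠ 0 := by
  rw [hom_eq] at hz
  fin_cases a
  · exact fun h0 => left_ne_zero_of_mul hz ((if_neg h).trans h0)
  · exact fun h0 => right_ne_zero_of_mul hz ((if_neg h).trans h0)

lemma trans_eq {i j : Fin 2 → Bool} {z : C2} (hz : quadricAtlas.hom i z j ≠ 0) (a : Fin 2) :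
    quadricAtlas.trans i j z a = if j a = i a then z a else (z a)⁻¹ := by
  have h : quadricAtlas.trans i j z a =
      quadricAtlas.hom i z (Function.update j a (!j a)) / quadricAtlas.hom i z j := rfl
  have h0 := fun h => ne_zero_of_hom hz (a := 0) h
  have h1 := fun h => ne_zero_of_hom hz (a := 1) h
  rw [h, hom_eq, hom_eq]
  fin_cases a <;> by_cases e0 : j 0 = i 0 <;> by_cases e1 : j 1 = i 1 <;>
    simp [e0, e1] <;> simp [e0, e1] at h0 h1
  all_goals first
    | rw [if_pos (Bool.eq_not.2 e0)]
    | rw [if_pos (Bool.eq_not.2 e1)]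
    | skip
  all_goals field_simp

/-- The derivative of the `a`-th coordinate of the change of charts. -/
def slope (i j : Fin 2 → Bool) (a : Fin 2) (x : ℂ) : ℂ := if j a = i a then 1 else -(x ^ 2)⁻¹

lemma hasFDerivAt_trans {i j : Fin 2 → Bool} {z : C2} (hz : quadricAtlas.hom i z j ≠ 0)
    (a : Fin 2) : HasFDerivAt (fun w => quadricAtlas.trans i j w a)
      (slope i j a (z a) • (ContinuousLinearMap.proj a : C2 →L[ℂ] ℂ)) z := by
  have hev : (fun w => quadricAtlas.trans i j w a) =ᶠ[𝓝 z]
      fun w => if j a = i a then w a else (w a)⁻¹ := by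
    filter_upwards [(quadricAtlas.isOpen_hom_ne_zero i j).mem_nhds hz] with w hw
    exact trans_eq hw a
  refine HasFDerivAt.congr_of_eventuallyEq ?_ hev
  have h : HasFDerivAt (fun z : C2 => z a) (ContinuousLinearMap.proj a : C2 →L[ℂ] ℂ) z :=
    (ContinuousLinearMap.proj a : C2 →L[ℂ] ℂ).hasFDerivAt
  unfold slope
  split_ifs with h1
  · simpa using h
  · exact (hasDerivAt_inv (ne_zero_of_hom hz h1)).comp_hasFDerivAt z h

lemma jac_eq {i j : Fin 2 → Bool} {z : C2} (hz : quadricAtlas.hom i z j ≠ 0) (a b : Fin 2) :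
    quadricAtlas.jac i j z a b = if a = b then slope i j a (z a) else 0 := by
  have h : fderiv ℂ (quadricAtlas.trans i j) z = _ :=
    (hasFDerivAt_pi.2 fun a => hasFDerivAt_trans hz a).fderiv
  rw [show quadricAtlas.jac i j z a b =
    fderiv ℂ (quadricAtlas.trans i j) z (Pi.single b 1) a from rfl, h]
  simp [Pi.single_apply]

lemma fderiv_jac {i j : Fin 2 → Bool} {z : C2} (hz : quadricAtlas.hom i z j ≠ 0) (a b c : Fin 2) :
    fderiv ℂ (fun w => quadricAtlas.jac i j w a b) z (Pi.single c 1) =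
      if a = b ∧ a = c then (if j a = i a then 0 else 2 / z a ^ 3) else 0 := by
  have hev : (fun w => quadricAtlas.jac i j w a b) =ᶠ[𝓝 z]
      fun w => if a = b then slope i j a (w a) else 0 := by
    filter_upwards [(quadricAtlas.isOpen_hom_ne_zero i j).mem_nhds hz] with w hw
    exact jac_eq hw a b
  rw [hev.fderiv_eq]
  by_cases hab : a = b
  · subst hab
    have h : HasFDerivAt (fun z : C2 => z a) (ContinuousLinearMap.proj a : C2 →L[ℂ] ℂ) z :=
      (ContinuousLinearMap.proj a : C2 →L[ℂ] ℂ).hasFDerivAt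
    by_cases h1 : j a = i a
    · simp [slope, h1]
    · have h0 := ne_zero_of_hom hz h1
      have h2 : HasDerivAt (fun x : ℂ => -(x ^ 2)⁻¹) (2 / z a ^ 3) (z a) := by
        refine ((hasDerivAt_pow 2 (z a)).fun_inv (pow_ne_zero 2 h0)).fun_neg.congr_deriv ?_
        field_simp
        push_cast
        ring
      have h3 : HasFDerivAt (fun w : C2 => -(w a ^ 2)⁻¹)
          ((2 / z a ^ 3) • (ContinuousLinearMap.proj a : C2 →L[ℂ] ℂ)) z :=
        HasDerivAt.comp_hasFDerivAt (h₂ := fun x : ℂ => -(x ^ 2)⁻¹) z h2 h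
      simp only [slope, if_true, true_and, h1, if_false]
      rw [h3.fderiv]
      simp [Pi.single_apply]
  · simp [hab]

lemma transform {i j : Fin 2 → Bool} {z : C2} (hz : quadricAtlas.hom i z j ≠ 0) (a b c : Fin 2) :
    ∑ k, quadricAtlas.jac i j z a k * (if k = b ∧ k = c then -2 * lineP k z else 0) =
      fderiv ℂ (fun w => quadricAtlas.jac i j w a b) z (Pi.single c 1) +
        ∑ k, ∑ l, (if a = k ∧ a = l then -2 * lineP a (quadricAtlas.trans i j z) else 0) *
            quadricAtlas.jac i j z l c * quadricAtlas.jac i j z k b := by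
  -- Everything is diagonal, so only the law for one projective line remains; its nontrivial case is
  -- the change of coordinate `x ↦ x⁻¹`.
  have key : slope i j a (z a) * (-2 * lineP a z) = (if j a = i a then 0 else 2 / z a ^ 3) +
      -2 * lineP a (quadricAtlas.trans i j z) * slope i j a (z a) * slope i j a (z a) := by
    have h3 := lineRho_ne_zero a z
    have h4 := lineRho_ne_zero a (quadricAtlas.trans i j z)
    simp only [lineP, lineRho, slope, trans_eq hz a] at h3 h4 ⊢
    split_ifs with h1
    · simp
    · simp only [if_neg h1] at h4
      have h0 := ne_zero_of_hom hz h1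
      have h0' : conj (z a) ≠ 0 := by simpa using h0
      have h5 : conj (z a)⁻¹ / (1 + (z a)⁻¹ * conj (z a)⁻¹) = z a / (1 + z a * conj (z a)) := by
        rw [div_eq_div_iff h4 h3, map_inv₀]
        field_simp
        ring
      rw [h5]
      field_simp
      ring
  rw [fderiv_jac hz]
  simp only [jac_eq hz, Fin.sum_univ_two]
  fin_cases a <;> fin_cases b <;> fin_cases c <;> simp at key ⊢ <;> exact key

/-- The Levi-Civita connection of the product of the Fubini-Study metrics. -/
def christoffel : quadricAtlas.Christoffel where
  Γ a b c z := if a = b ∧ a = c then -2 * lineP a z else 0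
  smooth a b c := by
    split_ifs
    exacts [contDiff_const.mul (contDiff_lineP a), contDiff_const]
  transform i j z hz a b c := transform hz a b c

lemma fderiv_christoffel (a b c : Fin 2) (z u : C2) : fderiv ℝ (christoffel.Γ a b c) z u =
    if a = b ∧ a = c then -2 * fderiv ℝ (lineP a) z u else 0 := by
  have h : DifferentiableAt ℝ (lineP a) z :=
    (contDiff_lineP a).contDiffAt.differentiableAt (by simp)
  have h1 : HasFDerivAt (christoffel.Γ a b c)
      (if a = b ∧ a = c then (-2 : ℂ) • fderiv ℝ (lineP a) z else 0) z := by
    simp only [christoffel]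
    split_ifs
    exacts [h.hasFDerivAt.const_mul (-2), hasFDerivAt_const _ _]
  rw [h1.fderiv]
  split_ifs <;> rfl

/-- The product of the Fubini-Study connections, with its Chern numbers. -/
def chernData : ChernData quadricAtlas where
  G := christoffel
  curv a b z := Matrix.of fun c k =>
    if a = b ∧ a = c ∧ a = k then -2 * (lineRho a z)⁻¹ ^ 2 else 0
  curvature_eq z a b u v := by
    -- Equivalently `ρ⁻¹ - |z|² ρ⁻² = ρ⁻²`, which simplifies `∂̄` of `lineP`.
    have h : ∀ a, (lineRho a z)⁻¹ = (lineRho a z)⁻¹ ^ 2 * (1 + z a * conj (z a)) := fun a => by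
      have := lineRho_ne_zero a z
      rw [show 1 + z a * conj (z a) = lineRho a z from rfl]
      field_simp
    have h0 := h 0
    have h1 := h 1
    simp only [MonomialAtlas.Christoffel.curvature, fderiv_christoffel, fderiv_lineP, hermForm]
    simp only [christoffel, lineP, Matrix.of_apply, Fin.sum_univ_two]
    fin_cases a <;> fin_cases b <;> simp
    · linear_combination 2 * (u 0 * conj (v 0) - conj (u 0) * v 0) * h0
    · linear_combination 2 * (u 1 * conj (v 1) - conj (u 1) * v 1) * h1
  -- The curvature is the direct sum of those of two lines, each with first Chern class of degree
  -- `2`; so `c₁² = 2 * 2 * 2` and `c₂ = 2 * 2`.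
  c₁sq := 8
  c₂ := 4
  density z := (Real.pi ^ 2)⁻¹ * (((1 + ‖z 0‖ ^ 2) ^ 2)⁻¹ * ((1 + ‖z 1‖ ^ 2) ^ 2)⁻¹)
  integrable := (integrable_and_integral_finTwo integrable_fubiniStudy_prod).1.const_mul _
  integral_eq_one := by
    have h := (integrable_and_integral_finTwo integrable_fubiniStudy_prod).2
    simp only at h
    rw [integral_const_mul, h, integral_fubiniStudy_prod]
    field_simp
  chern₁ z := by
    have hpi : (Real.pi : ℂ) ≠ 0 := by simp [Real.pi_ne_zero]
    have h0 := lineRho_eq 0 z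
    have h1 := lineRho_eq 1 z
    rw [wedgeCoeff_hermForm]
    push_cast at h0 h1 ⊢
    rw [← h0, ← h1]
    simp [div_pow]
    field_simp
    ring
  chern₂ z := by
    have hpi : (Real.pi : ℂ) ≠ 0 := by simp [Real.pi_ne_zero]
    have h0 := lineRho_eq 0 z
    have h1 := lineRho_eq 1 z
    rw [wedgeCoeff_hermForm, wedgeCoeff_hermForm]
    push_cast at h0 h1 ⊢
    rw [← h0, ← h1]
    simp [div_pow]
    field_simp

end quadricAtlas
end ToricSurf

namespace ToricSurf

open Topology MeasureTheory

/-! ### The tuples of disjoint unions -/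

/-- The trace of `θ ∧ θ` vanishes, so the trace of the curvature is `d (tr θ)`. -/
lemma TangentConnection.chernDForm_apply {S : Type} [TopologicalSpace S] [ChartedSpace C2 S]
    [IsManifold 𝓘(ℂ, C2) ω S] (D : TangentConnection S) {e : OpenPartialHomeomorph S C2}
    (he : e ∈ atlas C2 S) {z : C2} (hz : z ∈ e.target) (u v : C2) :
    D.chernDForm.toFun e z ![u, v] = D.chernForm₁ e z u v := by
  have hd : ∀ i, HasFDerivAt (D.θ e i i) (fderiv ℝ (D.θ e i i) z) z := fun i =>
    (((D.smooth e he i i).contDiffAt (e.open_target.mem_nhds hz)).differentiableAt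
      (by simp)).hasFDerivAt
  have h : fderiv ℝ (D.chernPrimitive e) z = (Complex.I / (2 * Real.pi)) •
      (fderiv ℝ (D.θ e 0 0) z + fderiv ℝ (D.θ e 1 1) z) :=
    (((hd 0).add (hd 1)).const_smul (Complex.I / (2 * Real.pi))).fderiv
  change extDeriv (D.chernPrimitive e) z ![u, v] = _
  simp only [chernForm₁, curvature, extDeriv, h,
    ContinuousAlternatingMap.alternatizeUncurryFin_apply, Fin.sum_univ_two]
  simp
  ring

namespace Union

variable {K : Type} {M : K → MonomialAtlas}

lemma isLocallyConstant_fst (a : K → ℚ) :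
    IsLocallyConstant fun x : Union M => a (Sigma.fst x) := by
  refine (IsLocallyConstant.iff_exists_open _).2 fun x => ?_
  refine ⟨Set.range (mk x.1), (isOpenEmbedding_mk x.1).isOpen_range, ⟨x.2, rfl⟩, ?_⟩
  rintro _ ⟨y, rfl⟩
  rfl

variable (C : ∀ k, ChernData (M k))

lemma chernForm₁_connection (c : Index M) (z : C2) :
    (connection fun k => (C k).G).chernForm₁ (chart c) z = fun u v =>
      Complex.I / (2 * Real.pi) *
        hermForm ((C c.1).curv 0 0 z + (C c.1).curv 1 1 z) u v := by
  ext u v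
  rw [TangentConnection.chernForm₁, connection_curvature, connection_curvature,
    (C c.1).curvature_eq, (C c.1).curvature_eq, hermForm_add]

/-- The multiple of the first Chern class by rational numbers on the components. -/
def multipleOfChernClass [Finite K] (a : K → ℚ) : RationalClass (Union M) :=
  (connection fun k => (C k).G).chernClass.smul (isLocallyConstant_fst a)

lemma multipleOfChernClass_apply [Finite K] (a : K → ℚ) (c : Index M) (z : C2) :
    (fun u v => (multipleOfChernClass C a).form.toFun (chart c) z ![u, v]) = fun u v =>
      (a c.1 : ℂ) * (connection fun k => (C k).G).chernForm₁ (chart c) z u v := by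
  ext u v
  rw [← TangentConnection.chernDForm_apply _ (chart_mem_atlas c) (Set.mem_univ _)]
  change ((a c.1 : ℚ) : ℝ) •
    ((connection fun k => (C k).G).chernDForm.toFun (chart c) z ![u, v]) = _
  rw [Complex.real_smul]
  simp

lemma wedgeCoeff_chernForm₁_connection (r s : ℂ) (c : Index M) (z : C2) :
    wedgeCoeff (fun u v => r * (connection fun k => (C k).G).chernForm₁ (chart c) z u v)
      (fun u v => s * (connection fun k => (C k).G).chernForm₁ (chart c) z u v) =
      r * s * (C c.1).c₁sq * (C c.1).density z := by
  rw [wedgeCoeff_smul, chernForm₁_connection, wedgeCoeff_smul]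
  linear_combination (r * s) * (C c.1).chern₁ z

lemma chernForm₂Coeff_connection (c : Index M) (z : C2) :
    (connection fun k => (C k).G).chernForm₂Coeff (chart c) z =
      (C c.1).c₂ * (C c.1).density z := by
  have h : ∀ i j, (connection fun k => (C k).G).curvature (chart c) z i j =
      hermForm ((C c.1).curv i j z) := fun i j => by
    ext u v
    rw [connection_curvature, (C c.1).curvature_eq]
  rw [← (C c.1).chern₂ z]
  simp only [TangentConnection.chernForm₂Coeff, h]

/-- The tuple of Chern numbers of a surface with Chern numbers `c₁sq` and `c₂` and of the multiples
of its first Chern class by the `a i`. -/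
def chernTuple {m : ℕ} (c₁sq c₂ : ℚ) (a : Fin m → ℚ) : TupleIndex m → ℚ :=
  Sum.elim (fun p => a p.1.1 * a p.1.2 * c₁sq) (Sum.elim (fun i => a i * c₁sq) ![c₁sq, c₂])

/-- On every component each integrand is a constant times the density of mass one, so each entry is
the sum of these constants. -/
lemma isTupleOf [Fintype K] [Nonempty K] {m : ℕ} (a : Fin m → K → ℚ) :
    IsTupleOf (toricSurface M) (fun i => multipleOfChernClass C (a i))
      (∑ k, chernTuple (C k).c₁sq (C k).c₂ fun i => a i k) := by
  have hI : ∀ (F : K → ℚ) (ρ : OpenPartialHomeomorph (Union M) C2 → C2 → ℂ) (q : ℚ),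
      (∀ (c : Index M) z, ρ (chart c) z = F c.1 * (C c.1).density z) → q = ∑ k, F k →
        HasIntegral (Union M) ρ q := by
    intro F ρ q hρ hq
    have h := hasIntegral (M := M) (w := fun k => (C k).density) (C := fun k => (F k : ℂ))
      (ρ := ρ) (fun k => (C k).integrable) (fun k => (C k).integral_eq_one) hρ
    rw [hq]
    push_cast
    exact h
  refine ⟨connection fun k => (C k).G, fun p => ?_, fun i => ?_, ?_, ?_⟩
  · refine hI (fun k => a p.1.1 k * a p.1.2 k * (C k).c₁sq) _ _ (fun c z => ?_) ?_
    · simp only [multipleOfChernClass_apply, wedgeCoeff_chernForm₁_connection]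
      push_cast
      rfl
    · simp [Finset.sum_apply, chernTuple]
  · refine hI (fun k => a i k * (C k).c₁sq) _ _ (fun c z => ?_) ?_
    · have h := wedgeCoeff_chernForm₁_connection C (a i c.1) 1 c z
      simp only [one_mul, mul_one] at h
      simp only [multipleOfChernClass_apply]
      push_cast
      exact h
    · simp [Finset.sum_apply, chernTuple]
  · refine hI (fun k => (C k).c₁sq) _ _ (fun c z => ?_) ?_
    · have h := wedgeCoeff_chernForm₁_connection C 1 1 c z
      simp only [one_mul] at h
      exact h
    · simp [Finset.sum_apply, chernTuple]
  · refine hI (fun k => (C k).c₂) _ _ (fun c z => ?_) ?_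
    · exact chernForm₂Coeff_connection C c z
    · simp [Finset.sum_apply, chernTuple]

end Union

/-! ### Zariski density -/

/-- A set that contains all finite nonempty sums of vectors of a spanning family is Zariski
dense. -/
theorem isZariskiDense_of_span_eq_top {σ V : Type} [Nonempty V] {T : Set (σ → ℚ)}
    (v : V → σ → ℚ) (hv : Submodule.span ℚ (Set.range v) = ⊤)
    (hT : ∀ (K : Type) [Fintype K] [Nonempty K] (f : K → V), ∑ k, v (f k) ∈ T) :
    IsZariskiDense T := by
  intro I hI
  refine Set.eq_univ_of_forall fun x p hp => ?_
  obtain ⟨c, hc⟩ := Finsupp.mem_span_range_iff_exists_finsupp.1 (hv ▸ Submodule.mem_top (x := x))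
  -- The extra index `none` keeps the family nonempty even when `x = 0`; its coefficient is set to
  -- zero at the end.
  let f : Option c.support → V := fun j => j.elim (Classical.arbitrary V) fun j => j
  let P : MvPolynomial (Option c.support) ℚ :=
    MvPolynomial.aeval (fun s => ∑ j, MvPolynomial.X j * MvPolynomial.C (v (f j) s)) p
  have hP : ∀ t, MvPolynomial.eval t P = MvPolynomial.aeval (∑ j, t j • v (f j)) p := by
    intro t
    have h : (MvPolynomial.aeval t).comp (MvPolynomial.aeval fun s =>
        ∑ j, MvPolynomial.X j * MvPolynomial.C (v (f j) s)) =
        MvPolynomial.aeval (R := ℚ) (∑ j, t j • v (f j)) := by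
      ext s
      simp [Finset.sum_apply]
    rw [← h]
    rfl
  -- Positive integer coefficients are multiplicities in a nonempty sum of the vectors, so `P`
  -- vanishes on a product of infinite sets.
  have hP0 : P = 0 := by
    refine MvPolynomial.funext_set (fun _ => Set.range fun n : ℕ => (n : ℚ) + 1)
      (fun _ => Set.infinite_range_of_injective fun a b h => by simpa using h) fun t ht => ?_
    choose n hn using fun j => ht j (Set.mem_univ j)
    rw [hP, map_zero]
    have h := hT (Σ j : Option c.support, Fin (n j + 1)) (fun k => f k.1)
    have h2 : ∑ k : (Σ j : Option c.support, Fin (n j + 1)), v (f k.1) =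
        ∑ j, t j • v (f j) := by
      rw [Fintype.sum_sigma]
      refine Finset.sum_congr rfl fun j _ => ?_
      rw [← hn j]
      simp [add_smul, Nat.cast_smul_eq_nsmul]
    exact hI (h2 ▸ h) p hp
  have hx : ∑ j, (j.elim 0 fun j => c j : ℚ) • v (f j) = x := by
    rw [Fintype.sum_option, ← hc, Finsupp.sum]
    simpa [f] using Finset.sum_coe_sort c.support fun a => c a • v a
  rw [← hx, ← hP fun j => j.elim 0 fun j => c j, hP0, map_zero]

/-- The projective plane or the product of two projective lines. -/
def planeOrQuadric : Bool → MonomialAtlas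
  | true => planeAtlas
  | false => quadricAtlas

/-- The Chern data of the two surfaces. -/
def planeOrQuadric.chernData : ∀ b, ChernData (planeOrQuadric b)
  | true => planeAtlas.chernData
  | false => quadricAtlas.chernData

lemma planeOrQuadric.c₁sq_chernData (b : Bool) :
    (chernData b).c₁sq = if b then 9 else 8 := by
  cases b <;> rfl

lemma planeOrQuadric.c₂_chernData (b : Bool) :
    (chernData b).c₂ = if b then 3 else 4 := by
  cases b <;> rfl

/-- The tuples of the projective plane and of the product of two projective lines span. -/
lemma span_chernTuple (m : ℕ) :
    Submodule.span ℚ (Set.range fun s : Bool × (Fin m → ℚ) =>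
      Union.chernTuple (if s.1 then 9 else 8) (if s.1 then 3 else 4) s.2) = ⊤ := by
  set W := Submodule.span ℚ (Set.range fun s : Bool × (Fin m → ℚ) =>
      Union.chernTuple (if s.1 then 9 else 8) (if s.1 then 3 else 4) s.2) with hW
  have h9 : ∀ a : Fin m → ℚ, Union.chernTuple 9 3 a ∈ W := fun a =>
    Submodule.subset_span ⟨(true, a), rfl⟩
  have h8 : ∀ a : Fin m → ℚ, Union.chernTuple 8 4 a ∈ W := fun a =>
    Submodule.subset_span ⟨(false, a), rfl⟩
  have hq : ∀ a : Fin m → ℚ, (Sum.elim (fun p => a p.1.1 * a p.1.2) 0 : TupleIndex m → ℚ) ∈ W := by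
    intro a
    -- The second difference at `a = 0` removes the linear and constant entries and doubles the
    -- quadratic ones; `18 = 2 * 9`.
    have h := W.smul_mem (1 / 18) (W.sub_mem (W.add_mem (h9 a) (h9 (-a)))
      (W.smul_mem (2 : ℚ) (h9 0)))
    convert h using 1
    ext (p | i | i)
    · simp [Union.chernTuple]
      ring
    · simp [Union.chernTuple]
    · fin_cases i <;> simp [Union.chernTuple] <;> ring
  have hl : ∀ a : Fin m → ℚ, (Sum.elim 0 (Sum.elim a 0) : TupleIndex m → ℚ) ∈ W := by
    intro a
    -- The odd part in `a` retains only the linear entries.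
    have h := W.smul_mem (1 / 18) (W.sub_mem (h9 a) (h9 (-a)))
    convert h using 1
    ext (p | i | i)
    · simp [Union.chernTuple]
    · simp [Union.chernTuple]
      ring
    · fin_cases i <;> simp [Union.chernTuple]
  have hs : ∀ s : TupleIndex m, (Pi.single s 1 : TupleIndex m → ℚ) ∈ W := by
    rintro (⟨⟨i, j⟩, hij⟩ | i | i)
    · rcases eq_or_lt_of_le hij with h | h
      · convert hq (Pi.single i 1) using 1
        simp only at h
        subst h
        ext (⟨⟨k, l⟩, hkl⟩ | k | k)
        · by_cases hk : k = i <;> by_cases hl : l = i <;> simp [Pi.single_apply, hk, hl]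
        · simp
        · simp
      · convert W.sub_mem (W.sub_mem (hq (Pi.single i 1 + Pi.single j 1)) (hq (Pi.single i 1)))
          (hq (Pi.single j 1)) using 1
        simp only at h hij
        ext (⟨⟨k, l⟩, hkl⟩ | k | k)
        · have h' : ¬ (k = j ∧ l = i) := fun hji => by
            rw [hji.1, hji.2] at hkl
            exact absurd hkl (not_le.2 h)
          simp only [Pi.single_apply, Pi.sub_apply, Pi.add_apply, Sum.elim_inl, Sum.inl.injEq,
            Subtype.mk.injEq, Prod.mk.injEq]
          by_cases h1 : k = i <;> by_cases h2 : l = i <;> by_cases h3 : k = j <;>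
            by_cases h4 : l = j <;> simp_all
        · simp
        · simp
    · convert hl (Pi.single i 1) using 1
      ext (p | k | k) <;> simp [Pi.single_apply]
    · fin_cases i
      -- The inverse of the matrix with rows `(9, 3)` and `(8, 4)`, of determinant `12`, supplies
      -- the coefficients here and in the next case.
      · convert W.smul_mem (1 / 12) (W.sub_mem (W.smul_mem (4 : ℚ) (h9 0)) (W.smul_mem (3 : ℚ)
          (h8 0))) using 1
        ext (p | k | k)
        · simp [Union.chernTuple]
        · simp [Union.chernTuple]
        · fin_cases k <;> simp [Union.chernTuple] <;> norm_num
      · convert W.smul_mem (1 / 12) (W.sub_mem (W.smul_mem (9 : ℚ) (h8 0)) (W.smul_mem (8 : ℚ)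
          (h9 0))) using 1
        ext (p | k | k)
        · simp [Union.chernTuple]
        · simp [Union.chernTuple]
        · fin_cases k <;> simp [Union.chernTuple] <;> norm_num
  refine eq_top_iff.2 fun q _ => ?_
  rw [pi_eq_sum_univ' q]
  refine W.sum_mem fun s _ => W.smul_mem _ ?_
  convert hs s using 1

end ToricSurf

end

theorem proposition3p5 (m : ℕ) :
    ToricSurf.IsZariskiDense
      {q : ToricSurf.TupleIndex m → ℚ |
        ∃ (S : ToricSurf.ToricSurface) (γ : Fin m → ToricSurf.RationalClass S.carrier),
          ToricSurf.IsTupleOf S γ q} := by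
  refine ToricSurf.isZariskiDense_of_span_eq_top _ (ToricSurf.span_chernTuple m) ?_
  intro K _ _ f
  let C := fun k => ToricSurf.planeOrQuadric.chernData (f k).1
  refine ⟨ToricSurf.Union.toricSurface _,
    fun i => ToricSurf.Union.multipleOfChernClass C fun k => (f k).2 i, ?_⟩
  convert ToricSurf.Union.isTupleOf C (fun i k => (f k).2 i) using 3 with k
  · exact (ToricSurf.planeOrQuadric.c₁sq_chernData _).symm
  · exact (ToricSurf.planeOrQuadric.c₂_chernData _).symm
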